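/- **Setting.** Let $\Gamma\subset\mathbb R^n$ be a bounded network: a connected union of finitely many nondegenerate straight segments (edges) $\Gamma_\alpha$, $\alpha\in\mathcal A$, which join vertices $\nu_i$, $i\in I$ ($I$ finite); each vertex is an endpoint of some edge, an edge contains no vertices other than its endpoints, and two distinct edges are disjoint or meet in a single vertex. Each edge is oriented arbitrarily and parametrized by arc length, $\pi_\alpha:[0,\ell_\alpha]\to\Gamma_\alpha$; write $u_\alpha=u\circ\pi_\alpha$, let $\partial$ be the (weak) derivative in the edge coordinate, and $\int_\Gamma u\,dx=\sum_\alpha\int_0^{\ell_\alpha}u_\alpha\,dy$. Let $\mathcal A_i=\{\alpha:\nu_i\in\Gamma_\alpha\}$ and, for $u$ with $u_\alpha\in H^1(0,\ell_\alpha)$, let $u|_{\Gamma_\alpha}(\nu_i)$ be the value at $\pi_\alpha^{-1}(\nu_i)$ of the representative of $u_\alpha$ continuous on $[0,\ell_\alpha]$. Set $$H^s_b(\Gamma)=\{u:\ u_\alpha\in H^s(0,\ell_\alpha)\ \forall\alpha\},\qquad H^s(\Gamma)=C(\Gamma)\cap H^s_b(\Gamma),$$ $$W=\Bigl\{w\in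 H^1_b(\Gamma):\ \tfrac{w|_{\Gamma_\alpha}(\nu_i)}{\gamma_{i\alpha}}=\tfrac{w|_{\Gamma_\beta}(\nu_i)}{\gamma_{i\beta}}\ \ \forall i\in I,\ \alpha,\beta\in\mathcal A_i\Bigr\}.$$ **Assumptions.** $T>0$; $\mu_\alpha>0$ for all $\alpha$; $\gamma_{i\alpha}>0$ for $\alpha\in\mathcal A_i$ and $\sum_{\alpha\in\mathcal A_i}\gamma_{i\alpha}\mu_\alpha=1$ for all $i$. The Hamiltonian $H$ is a collection of functions $H^\alpha\in C^1(\Gamma_\alpha\times\mathbb R)$, convex in $p$, such that for some constant $C_0$ and all $\alpha$, $(x,p)\in\Gamma_\alpha\times\mathbb R$: $H^\alpha(x,p)\le C_0(|p|+1)$, $|\partial_pH^\alpha(x,p)|\le C_0$, $|\partial_xH^\alpha(x,p)|\le C_0(|p|+1)$. Moreover $f\in L^2(\Gamma\times(0,T))$ and $v_T\in H^1(\Gamma)$. Let $v,\hat v\in L^2(0,T;H^2(\Gamma))$ with $\partial_tv,\partial_t\hat v\in L^2(\Gamma\times(0,T))$, identified with their representatives in $C([0,T];L^2(\Gamma))$,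 be a weak sub- and supersolution of $$-\partial_tv-\mu_\alpha\partial^2v+H(x,\partial v)=f\ \text{ in the edges},\qquad \sum_{\alpha\in\mathcal A_i}\gamma_{i\alpha}\mu_\alpha\partial_\alpha v(\nu_i,t)=0,\qquad v(\cdot,T)=v_T$$ (with $\partial_\alpha$ the outward derivative along $\Gamma_\alpha$ at $\nu_i$), that is: for every $w\in W$ with $w\ge0$ and a.e. $t\in(0,T)$, $$\int_\Gamma\bigl(-\partial_tv\,w+\mu\,\partial v\,\partial w+H(x,\partial v)w\bigr)dx\le\int_\Gamma fw\,dx\le\int_\Gamma\bigl(-\partial_t\hat v\,w+\mu\,\partial\hat v\,\partial w+H(x,\partial\hat v)w\bigr)dx,$$ where $\mu=\mu_\alpha$ and $H=H^\alpha$ on $\Gamma_\alpha$, and $v(x,T)\le v_T(x)\le\hat v(x,T)$ for a.e. $x\in\Gamma$. **Conclusion.** $v\le\hat v$ in $\Gamma\times(0,T)$: for every $t\in(0,T)$, $v(x,t)\le\hat v(x,t)$ for a.e. $x\in\Gamma$, and for every $x\in\Gamma$ whenever $v(\cdot,t)$ and $\hat v(\cdot,t)$ are continuous on $\Gamma$.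 -/

import Mathlib

open MeasureTheory Set Filter Topology
open scoped ContDiff

noncomputable section

namespace HJNetwork

/-! ### Networks -/

/-- A bounded network in `ℝⁿ` (`I` indexes the vertices, `A` the edges): a connected union of
finitely many nondegenerate straight segments which join vertices and meet only at vertices.
Each edge is oriented, in an arbitrary manner, from `src` to `tgt`. -/
structure Network (n : ℕ) (I A : Type*) where
  vertex : I → EuclideanSpace ℝ (Fin n)
  vertex_injective : Function.Injective vertex
  src : A → I
  tgt : A → I
  src_ne_tgt : ∀ α, src α ≠ tgt α
  eq_src_or_eq_tgt : ∀ i α, vertex i ∈ segment ℝ (vertex (src α)) (vertex (tgt α)) →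
    i = src α ∨ i = tgt α
  exists_edge : ∀ i, ∃ α, i = src α ∨ i = tgt α
  inter : ∀ α β, α ≠ β →
    segment ℝ (vertex (src α)) (vertex (tgt α)) ∩ segment ℝ (vertex (src β)) (vertex (tgt β)) = ∅ ∨
    ∃ i, segment ℝ (vertex (src α)) (vertex (tgt α)) ∩
      segment ℝ (vertex (src β)) (vertex (tgt β)) = {vertex i}
  connected : IsConnected (⋃ α, segment ℝ (vertex (src α)) (vertex (tgt α)))

namespace Network

variable {n : ℕ} {I A : Type*} (N : Network n I A)

/-- The closed edge `Γ_α`. -/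
def edge (α : A) : Set (EuclideanSpace ℝ (Fin n)) :=
  segment ℝ (N.vertex (N.src α)) (N.vertex (N.tgt α))

/-- The network `Γ` as a subset of `ℝⁿ`. A function on `Γ` is a function on `ℝⁿ` of which only the
values on `Γ` are used. -/
def carrier : Set (EuclideanSpace ℝ (Fin n)) := ⋃ α, N.edge α

/-- The length `ℓ_α`. -/
def length (α : A) : ℝ := dist (N.vertex (N.src α)) (N.vertex (N.tgt α))

/-- The arc length parametrization `π_α : [0, ℓ_α] → Γ_α`. -/
def param (α : A) (y : ℝ) : EuclideanSpace ℝ (Fin n) :=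
  AffineMap.lineMap (N.vertex (N.src α)) (N.vertex (N.tgt α)) (y / N.length α)

/-- `v_α = v ∘ π_α`. -/
def pull (v : EuclideanSpace ℝ (Fin n) → ℝ) (α : A) (y : ℝ) : ℝ := v (N.param α y)

open Classical in
/-- `𝓐_i`, the set of the edges adjacent to the vertex `ν_i`. -/
def adjacent [Fintype A] (i : I) : Finset A := Finset.univ.filter fun α => N.vertex i ∈ N.edge α

open Classical in
/-- The coordinate `π_α⁻¹(ν_i) ∈ {0, ℓ_α}` of an endpoint `ν_i` of `Γ_α`. -/
def coord (α : A) (i : I) : ℝ := if i = N.src α then 0 else N.length α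

/-- The measure `dy` on `(0, ℓ_α)`. -/
def edgeMeasure (α : A) : Measure ℝ := volume.restrict (Ioo 0 (N.length α))

/-- The measure `dy dt` on `(0, ℓ_α) × (0, T)`. -/
def edgeTimeMeasure (T : ℝ) (α : A) : Measure (ℝ × ℝ) :=
  volume.restrict (Ioo 0 (N.length α) ×ˢ Ioo 0 T)

/-- `P x` for almost every `x ∈ Γ`. -/
def AE (P : EuclideanSpace ℝ (Fin n) → Prop) : Prop :=
  ∀ α, ∀ᵐ y ∂(N.edgeMeasure α), P (N.param α y)

/-- `f ∈ L²(Γ × (0, T))`. -/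
def MemL2SpaceTime (T : ℝ) (f : EuclideanSpace ℝ (Fin n) → ℝ → ℝ) : Prop :=
  ∀ α, MemLp (fun z : ℝ × ℝ => f (N.param α z.1) z.2) 2 (N.edgeTimeMeasure T α)

end Network

/-! ### Weak derivatives and function spaces -/

/-- `g` is the weak derivative of `u` on the open interval `(a, b)`. -/
def HasWeakDerivOn (a b : ℝ) (u g : ℝ → ℝ) : Prop :=
  LocallyIntegrableOn u (Ioo a b) ∧ LocallyIntegrableOn g (Ioo a b) ∧
  ∀ φ : ℝ → ℝ, ContDiff ℝ ∞ φ → HasCompactSupport φ → tsupport φ ⊆ Ioo a b →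
    ∫ y in Ioo a b, u y * deriv φ y = - ∫ y in Ioo a b, g y * φ y

section Spaces

variable {n : ℕ} {I A : Type*} [Fintype A] (N : Network n I A)

/-- `v ∈ H¹_b(Γ)`: on each edge, `v_α ∈ H¹(0, ℓ_α)`. -/
def MemH1b (v : EuclideanSpace ℝ (Fin n) → ℝ) : Prop :=
  ∀ α, MemLp (N.pull v α) 2 (N.edgeMeasure α) ∧
    ∃ g : ℝ → ℝ, HasWeakDerivOn 0 (N.length α) (N.pull v α) g ∧ MemLp g 2 (N.edgeMeasure α)

/-- `v ∈ V = H¹(Γ) = C(Γ) ∩ H¹_b(Γ)`. -/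
def MemV (v : EuclideanSpace ℝ (Fin n) → ℝ) : Prop :=
  ContinuousOn v N.carrier ∧ MemH1b N v

/-- `w ∈ W`: `w ∈ H¹_b(Γ)` and `w|_{Γ_α}(ν_i) / γ_{iα} = w|_{Γ_β}(ν_i) / γ_{iβ}` for all edges
`Γ_α`, `Γ_β` adjacent to `ν_i`. Here `w|_{Γ_α}(ν_i)` is the endpoint value of the representative
of `w_α` which is continuous on `[0, ℓ_α]`. -/
def MemW (γ : I → A → ℝ) (w : EuclideanSpace ℝ (Fin n) → ℝ) : Prop :=
  MemH1b N w ∧ ∃ r : A → ℝ → ℝ,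
    (∀ α, ContinuousOn (r α) (Icc 0 (N.length α)) ∧ N.pull w α =ᵐ[N.edgeMeasure α] r α) ∧
    ∀ i, ∀ α ∈ N.adjacent i, ∀ β ∈ N.adjacent i,
      r α (N.coord α i) / γ i α = r β (N.coord β i) / γ i β

/-- `v ∈ L²(0, T; H²(Γ))` and `∂_t v ∈ L²(Γ × (0, T))`, with `v_t = ∂_t v` and `v_x = ∂v` in the
coordinates of the edges. As usual, `v` is the representative which belongs to `C([0, T]; L²(Γ))`
(this is what gives its meaning to `v(·, T)`). -/
structure InSolutionSpace (T : ℝ) (v : EuclideanSpace ℝ (Fin n) → ℝ → ℝ)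
    (v_t v_x : A → ℝ → ℝ → ℝ) : Prop where
  memL2 : N.MemL2SpaceTime T v
  memL2_x : ∀ α, MemLp (fun z : ℝ × ℝ => v_x α z.1 z.2) 2 (N.edgeTimeMeasure T α)
  memL2_t : ∀ α, MemLp (fun z : ℝ × ℝ => v_t α z.1 z.2) 2 (N.edgeTimeMeasure T α)
  weakDeriv_x : ∀ α, ∀ᵐ t ∂(volume.restrict (Ioo 0 T)),
    HasWeakDerivOn 0 (N.length α) (N.pull (fun x => v x t) α) (fun y => v_x α y t)
  weakDeriv_xx : ∃ v_xx : A → ℝ → ℝ → ℝ, ∀ α,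
    MemLp (fun z : ℝ × ℝ => v_xx α z.1 z.2) 2 (N.edgeTimeMeasure T α) ∧
    ∀ᵐ t ∂(volume.restrict (Ioo 0 T)),
      HasWeakDerivOn 0 (N.length α) (fun y => v_x α y t) (fun y => v_xx α y t)
  continuousOn : ∀ᵐ t ∂(volume.restrict (Ioo 0 T)), ContinuousOn (fun x => v x t) N.carrier
  weakDeriv_t : ∀ α, ∀ φ : ℝ × ℝ → ℝ, ContDiff ℝ ∞ φ → HasCompactSupport φ →
    tsupport φ ⊆ Ioo 0 (N.length α) ×ˢ Ioo 0 T →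
    ∫ z, v (N.param α z.1) z.2 * deriv (fun s => φ (z.1, s)) z.2 ∂(N.edgeTimeMeasure T α) =
      - ∫ z, v_t α z.1 z.2 * φ z ∂(N.edgeTimeMeasure T α)
  slice_memL2 : ∀ t ∈ Icc 0 T, ∀ α, MemLp (N.pull (fun x => v x t) α) 2 (N.edgeMeasure α)
  time_continuous : ∀ t₀ ∈ Icc 0 T, ∀ α,
    Tendsto (fun t => eLpNorm (fun y => v (N.param α y) t - v (N.param α y) t₀) 2
      (N.edgeMeasure α)) (𝓝[Icc 0 T] t₀) (𝓝 0)

/-! ### The Hamilton-Jacobi problem -/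

/-- Assumptions on the diffusion constants and on the jump coefficients. -/
structure CoefficientAssumptions (μ : A → ℝ) (γ : I → A → ℝ) : Prop where
  mu_pos : ∀ α, 0 < μ α
  gamma_pos : ∀ i, ∀ α ∈ N.adjacent i, 0 < γ i α
  sum_eq_one : ∀ i, ∑ α ∈ N.adjacent i, γ i α * μ α = 1

/-- Assumptions on the Hamiltonian, a collection of functions `H^α : Γ_α × ℝ → ℝ`; regularity and
derivatives in `x ∈ Γ_α` are those in the arc length coordinate `y ∈ [0, ℓ_α]`. -/
structure HamiltonianAssumptions (C₀ : ℝ) (H : A → EuclideanSpace ℝ (Fin n) → ℝ → ℝ) : Prop where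
  contDiffOn : ∀ α, ContDiffOn ℝ 1 (fun z : ℝ × ℝ => H α (N.param α z.1) z.2)
    (Icc 0 (N.length α) ×ˢ univ)
  convex : ∀ α, ∀ x ∈ N.edge α, ConvexOn ℝ univ (H α x)
  le : ∀ α, ∀ x ∈ N.edge α, ∀ p, H α x p ≤ C₀ * (|p| + 1)
  abs_deriv_p_le : ∀ α, ∀ x ∈ N.edge α, ∀ p, |deriv (H α x) p| ≤ C₀
  abs_deriv_x_le : ∀ α, ∀ y ∈ Icc 0 (N.length α), ∀ p,
    |derivWithin (fun s => H α (N.param α s) p) (Icc 0 (N.length α)) y| ≤ C₀ * (|p| + 1)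

/-- `∫_Γ (-∂_t v w + μ ∂v ∂w + H(x, ∂v) w) dx` at time `t`. -/
def weakForm (μ : A → ℝ) (H : A → EuclideanSpace ℝ (Fin n) → ℝ → ℝ) (v_t v_x : A → ℝ → ℝ → ℝ)
    (w : EuclideanSpace ℝ (Fin n) → ℝ) (w_x : A → ℝ → ℝ) (t : ℝ) : ℝ :=
  ∑ α, ∫ y, (-(v_t α y t) * N.pull w α y + μ α * v_x α y t * w_x α y
    + H α (N.param α y) (v_x α y t) * N.pull w α y) ∂(N.edgeMeasure α)

/-- `∫_Γ f w dx` at time `t`. -/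
def sourceForm (f : EuclideanSpace ℝ (Fin n) → ℝ → ℝ) (w : EuclideanSpace ℝ (Fin n) → ℝ)
    (t : ℝ) : ℝ :=
  ∑ α, ∫ y, f (N.param α y) t * N.pull w α y ∂(N.edgeMeasure α)

/-- Weak subsolution of the Hamilton-Jacobi problem with terminal datum `vT`. -/
def IsWeakSubsolution (T : ℝ) (μ : A → ℝ) (γ : I → A → ℝ)
    (H : A → EuclideanSpace ℝ (Fin n) → ℝ → ℝ) (f : EuclideanSpace ℝ (Fin n) → ℝ → ℝ)
    (vT : EuclideanSpace ℝ (Fin n) → ℝ) (v : EuclideanSpace ℝ (Fin n) → ℝ → ℝ) : Prop :=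
  ∃ v_t v_x : A → ℝ → ℝ → ℝ, InSolutionSpace N T v v_t v_x ∧
    (∀ w : EuclideanSpace ℝ (Fin n) → ℝ, MemW N γ w → (∀ x ∈ N.carrier, 0 ≤ w x) →
      ∀ w_x : A → ℝ → ℝ, (∀ α, HasWeakDerivOn 0 (N.length α) (N.pull w α) (w_x α)) →
        ∀ᵐ t ∂(volume.restrict (Ioo 0 T)),
          weakForm N μ H v_t v_x w w_x t ≤ sourceForm N f w t) ∧
    N.AE fun x => v x T ≤ vT x

/-- Weak supersolution of the Hamilton-Jacobi problem with terminal datum `vT`. -/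
def IsWeakSupersolution (T : ℝ) (μ : A → ℝ) (γ : I → A → ℝ)
    (H : A → EuclideanSpace ℝ (Fin n) → ℝ → ℝ) (f : EuclideanSpace ℝ (Fin n) → ℝ → ℝ)
    (vT : EuclideanSpace ℝ (Fin n) → ℝ) (v : EuclideanSpace ℝ (Fin n) → ℝ → ℝ) : Prop :=
  ∃ v_t v_x : A → ℝ → ℝ → ℝ, InSolutionSpace N T v v_t v_x ∧
    (∀ w : EuclideanSpace ℝ (Fin n) → ℝ, MemW N γ w → (∀ x ∈ N.carrier, 0 ≤ w x) →
      ∀ w_x : A → ℝ → ℝ, (∀ α, HasWeakDerivOn 0 (N.length α) (N.pull w α) (w_x α)) →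
        ∀ᵐ t ∂(volume.restrict (Ioo 0 T)),
          sourceForm N f w t ≤ weakForm N μ H v_t v_x w w_x t) ∧
    N.AE fun x => vT x ≤ v x T

end Spaces

end HJNetwork

end

open scoped NNReal

noncomputable section

namespace HJNetwork

/-! ### Test functions and weak derivatives on an interval -/

/-! Write `u = v - v̂`, and let `φ` be the weight that is affine on each edge with endpoint values
`γ_{iα}`. For almost every `t` the function `u(·,t)` is continuous on the network, so `w = φ u⁺`
satisfies the jump conditions of `W` and may be used as a test function. Subtracting the two weak
inequalities cancels `f` and leaves `∫ φ u⁺ ∂_t u` bounded below by the diffusion term plus the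
Hamiltonian term. The Hamiltonian is `C₀`-Lipschitz in `p` and `|φ'| ≤ R φ`, so completing a square
absorbs every gradient into `μ φ |∂u|²`. For the energy `E(t) = ∫ φ (u⁺)²` this gives `E' ≥ -K E`,
while `E(T) = 0`. Gronwall's lemma run backward from `T` yields `E ≤ 0`, hence `u⁺ = 0`.

Two points need care. The null set of times in the weak inequality may depend on `w`, whereas `φ
u⁺(·,t)` changes with `t`; separability of `L²` provides one null set for all test functions
(`ae_forall_sum_integral_nonpos`). Moreover `E' = 2 ∫ φ u⁺ ∂_t u` has to be derived from a weak time
derivative: `ae_eq_sub_integral` shows that `v(y,t) = v(y,T) - ∫_t^T ∂_t v` for every `t` and almost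
every `y`, and `energy_identity` applies the chain rule for fixed `y` and then Fubini. The estimate
is `ae_neg_energy_le`, and `nonpos_of_backward_gronwall` concludes. -/

/-- `φ` is a smooth function with compact support in `(a, b)`. -/
structure IsTest (a b : ℝ) (φ : ℝ → ℝ) : Prop where
  contDiff : ContDiff ℝ ∞ φ
  hasCompactSupport : HasCompactSupport φ
  tsupport_subset : tsupport φ ⊆ Ioo a b

namespace IsTest

variable {a b : ℝ} {φ ψ : ℝ → ℝ}

theorem continuous (h : IsTest a b φ) : Continuous φ := h.contDiff.continuous

theorem eq_zero (h : IsTest a b φ) {x : ℝ} (hx : x ∉ Ioo a b) : φ x = 0 :=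
  image_eq_zero_of_notMem_tsupport fun h' => hx (h.tsupport_subset h')

theorem continuous_deriv (h : IsTest a b φ) : Continuous (deriv φ) :=
  h.contDiff.continuous_deriv (by simp)

theorem exists_bound (h : IsTest a b φ) : ∃ C, ∀ x, ‖φ x‖ ≤ C :=
  h.hasCompactSupport.exists_bound_of_continuous h.continuous

theorem exists_bound_deriv (h : IsTest a b φ) : ∃ C, ∀ x, ‖deriv φ x‖ ≤ C :=
  h.hasCompactSupport.deriv.exists_bound_of_continuous h.continuous_deriv

theorem sub_const_mul (hφ : IsTest a b φ) (hψ : IsTest a b ψ) (c : ℝ) :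
    IsTest a b (fun x => φ x - c * ψ x) where
  contDiff := hφ.contDiff.sub (contDiff_const.mul hψ.contDiff)
  hasCompactSupport := hφ.hasCompactSupport.sub hψ.hasCompactSupport.mul_left
  tsupport_subset := by
    refine (tsupport_sub φ (fun x => c * ψ x)).trans (union_subset hφ.tsupport_subset ?_)
    exact (tsupport_mul_subset_right (f := fun _ => c) (g := ψ)).trans hψ.tsupport_subset

theorem integrable_mul (hφ : IsTest a b φ) {h : ℝ → ℝ} (hh : IntegrableOn h (Ioo a b)) :
    IntegrableOn (fun x => h x * φ x) (Ioo a b) := by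
  obtain ⟨C, hC⟩ := hφ.exists_bound
  exact hh.mul_bdd hφ.continuous.aestronglyMeasurable (ae_of_all _ hC)

theorem integrable_mul_deriv (hφ : IsTest a b φ) {h : ℝ → ℝ} (hh : IntegrableOn h (Ioo a b)) :
    IntegrableOn (fun x => h x * deriv φ x) (Ioo a b) := by
  obtain ⟨C, hC⟩ := hφ.exists_bound_deriv
  exact hh.mul_bdd hφ.continuous_deriv.aestronglyMeasurable (ae_of_all _ hC)

theorem setIntegral_eq (hφ : IsTest a b φ) : ∫ x in Ioo a b, φ x = ∫ x, φ x :=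
  setIntegral_eq_integral_of_forall_compl_eq_zero fun _ hx => hφ.eq_zero hx

/-- A test function with vanishing integral is the derivative of a test function. -/
theorem exists_primitive (hab : a < b) (hφ : IsTest a b φ) (h0 : ∫ x, φ x = 0) :
    ∃ ψ, IsTest a b ψ ∧ deriv ψ = φ := by
  obtain ⟨c, d, hc, hd, hK⟩ : ∃ c d, a < c ∧ d < b ∧ tsupport φ ⊆ Icc c d := by
    rcases (tsupport φ).eq_empty_or_nonempty with h | h
    · exact ⟨(a + b) / 2, (a + b) / 2, by linarith, by linarith, by simp [h]⟩
    · obtain ⟨c, hc, hc'⟩ := hφ.hasCompactSupport.isCompact.exists_isLeast h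
      obtain ⟨d, hd, hd'⟩ := hφ.hasCompactSupport.isCompact.exists_isGreatest h
      exact ⟨c, d, (hφ.tsupport_subset hc).1, (hφ.tsupport_subset hd).2,
        fun x hx => ⟨hc' hx, hd' hx⟩⟩
  have hz : ∀ x, x ∉ Icc c d → φ x = 0 := fun x hx =>
    image_eq_zero_of_notMem_tsupport fun h' => hx (hK h')
  have hderiv : ∀ x, HasDerivAt (fun x => ∫ s in a..x, φ s) (φ x) x := fun x =>
    intervalIntegral.integral_hasDerivAt_right (hφ.continuous.intervalIntegrable _ _)
      (hφ.continuous.stronglyMeasurableAtFilter _ _) hφ.continuous.continuousAt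
  -- Left of `c` the integrand vanishes; right of `d` the integral has collected all of `φ`, whose
  -- total is zero.
  have hψz : ∀ x, x ∉ Icc c d → ∫ s in a..x, φ s = 0 := by
    intro x hx
    by_cases hxc : x < c
    · refine intervalIntegral.integral_zero_ae (ae_of_all _ fun s hs => hz s fun hs' => ?_)
      rcases le_total a x with h | h
      · rw [uIoc_of_le h] at hs; linarith [hs.2, hs'.1]
      · rw [uIoc_of_ge h] at hs; linarith [hs.2, hs'.1]
    · have hdx : d < x := by
        by_contra h
        exact hx ⟨not_lt.1 hxc, not_lt.1 h⟩
      have hax : a ≤ x := by linarith [not_lt.1 hxc]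
      rw [intervalIntegral.integral_of_le hax, ← h0]
      refine setIntegral_eq_integral_of_forall_compl_eq_zero fun y hy => hz y fun hy' => hy ?_
      exact ⟨by linarith [hy'.1], by linarith [hy'.2]⟩
  have hts : tsupport (fun x => ∫ s in a..x, φ s) ⊆ Icc c d :=
    closure_minimal (fun x hx => by_contra fun h => hx (hψz x h)) isClosed_Icc
  refine ⟨fun x => ∫ s in a..x, φ s, ⟨?_, ?_, ?_⟩, funext fun x => (hderiv x).deriv⟩
  · refine contDiff_infty_iff_deriv.2 ⟨fun x => (hderiv x).differentiableAt, ?_⟩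
    rw [funext fun x => (hderiv x).deriv]
    exact hφ.contDiff
  · exact HasCompactSupport.of_support_subset_isCompact isCompact_Icc
      ((subset_tsupport _).trans hts)
  · exact hts.trans fun x hx => ⟨by linarith [hx.1], by linarith [hx.2]⟩

end IsTest

theorem exists_isTest_integral_eq_one {a b : ℝ} (hab : a < b) :
    ∃ χ, IsTest a b χ ∧ ∫ x, χ x = 1 := by
  let f : ContDiffBump ((a + b) / 2) := ⟨(b - a) / 8, (b - a) / 4, by linarith, by linarith⟩
  refine ⟨f.normed volume, ⟨f.contDiff_normed, f.hasCompactSupport_normed, ?_⟩,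
    f.integral_normed⟩
  rw [f.tsupport_normed_eq, Real.closedBall_eq_Icc]
  intro x hx
  have h1 : (a + b) / 2 - (b - a) / 4 ≤ x := hx.1
  have h2 : x ≤ (a + b) / 2 + (b - a) / 4 := hx.2
  exact ⟨by linarith, by linarith⟩

/-- The lemma of du Bois-Reymond. -/
theorem ae_eq_const_of_integral_mul_deriv_eq_zero {a b : ℝ} (hab : a < b) {h : ℝ → ℝ}
    (hh : IntegrableOn h (Ioo a b))
    (H : ∀ ψ, IsTest a b ψ → ∫ y in Ioo a b, h y * deriv ψ y = 0) :
    ∃ c, ∀ᵐ y ∂(volume.restrict (Ioo a b)), h y = c := by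
  obtain ⟨χ, hχ, hχ1⟩ := exists_isTest_integral_eq_one hab
  -- Since `∫ χ = 1`, no other constant is possible. For any test function `η`, the function `η - (∫
  -- η) χ` has integral zero, so it is a derivative and is annihilated by `h`; this says `∫ (h - c)
  -- η = 0`.
  refine ⟨∫ y in Ioo a b, h y * χ y, ?_⟩
  set c := ∫ y in Ioo a b, h y * χ y with hc
  have hconst : IntegrableOn (fun _ : ℝ => c) (Ioo a b) := by simp
  have key : ∀ᵐ y, y ∈ Ioo a b → h y - c = 0 := by
    refine isOpen_Ioo.ae_eq_zero_of_integral_contDiff_smul_eq_zero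
      (hh.sub hconst).locallyIntegrableOn ?_
    intro η h1 h2 h3
    have hη : IsTest a b η := ⟨h1, h2, h3⟩
    have hi : ∀ {φ : ℝ → ℝ}, IsTest a b φ → Integrable φ := fun hφ =>
      hφ.continuous.integrable_of_hasCompactSupport hφ.hasCompactSupport
    obtain ⟨ψ, hψ, hψd⟩ := (hη.sub_const_mul hχ (∫ x, η x)).exists_primitive hab (by
      rw [integral_sub (hi hη) ((hi hχ).const_mul _), integral_const_mul, hχ1]; ring)
    have h4 := H ψ hψ
    simp only [hψd] at h4
    have e1 : ∫ y in Ioo a b, h y * (η y - (∫ x, η x) * χ y) =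
        (∫ y in Ioo a b, h y * η y) - (∫ x, η x) * c := by
      rw [hc, ← integral_const_mul, ← integral_sub (hη.integrable_mul hh)
        ((hχ.integrable_mul hh).const_mul _)]
      congr 1; ext y; ring
    have e2 : ∫ x, η x • (h x - c) = ∫ x in Ioo a b, η x • (h x - c) :=
      (setIntegral_eq_integral_of_forall_compl_eq_zero fun x hx => by
        rw [hη.eq_zero hx, zero_smul]).symm
    have e3 : ∫ x in Ioo a b, η x • (h x - c) =
        (∫ y in Ioo a b, h y * η y) - (∫ x, η x) * c := by
      rw [← hη.setIntegral_eq, ← integral_mul_const, ← integral_sub (hη.integrable_mul hh)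
        ((hi hη).integrableOn.mul_const _)]
      congr 1; ext y; simp only [smul_eq_mul]; ring
    rw [e2, e3, ← e1, h4]
  rw [ae_restrict_iff' measurableSet_Ioo]
  filter_upwards [key] with y hy hy'
  linarith [hy hy']

/-! ### Absolutely continuous functions and weak derivatives. -/

theorem _root_.AbsolutelyContinuousOnInterval.comp_lipschitz {f F : ℝ → ℝ} {a b : ℝ} {K : ℝ≥0}
    (hF : LipschitzWith K F) (hf : AbsolutelyContinuousOnInterval f a b) :
    AbsolutelyContinuousOnInterval (fun x => F (f x)) a b := by
  unfold AbsolutelyContinuousOnInterval at hf ⊢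
  refine squeeze_zero' (Eventually.of_forall fun E => Finset.sum_nonneg fun _ _ => dist_nonneg)
    (Eventually.of_forall fun E => ?_) (by simpa using hf.const_mul (K : ℝ))
  rw [Finset.mul_sum]
  exact Finset.sum_le_sum fun i _ => hF.dist_le_mul _ _

theorem _root_.AbsolutelyContinuousOnInterval.max_zero {f : ℝ → ℝ} {a b : ℝ}
    (hf : AbsolutelyContinuousOnInterval f a b) :
    AbsolutelyContinuousOnInterval (fun x => max (f x) 0) a b :=
  hf.comp_lipschitz (F := fun s => max s 0) (LipschitzWith.id.max_const 0)

theorem _root_.AbsolutelyContinuousOnInterval.const_add {f : ℝ → ℝ} {a b : ℝ} (c : ℝ)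
    (hf : AbsolutelyContinuousOnInterval f a b) :
    AbsolutelyContinuousOnInterval (fun x => c + f x) a b :=
  hf.comp_lipschitz (F := fun s => c + s) (K := 1)
    (LipschitzWith.of_dist_le_mul fun x y => by simp)

theorem _root_.AbsolutelyContinuousOnInterval.congr_of_eqOn {f g : ℝ → ℝ} {a b : ℝ}
    (hf : AbsolutelyContinuousOnInterval f a b) (hfg : EqOn f g (uIcc a b)) :
    AbsolutelyContinuousOnInterval g a b := by
  rw [absolutelyContinuousOnInterval_iff] at hf ⊢
  intro ε hε
  obtain ⟨δ, hδ, h⟩ := hf ε hε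
  refine ⟨δ, hδ, fun E hE hlt => ?_⟩
  refine lt_of_eq_of_lt (Finset.sum_congr rfl fun i hi => ?_) (h E hE hlt)
  have := hE.1 i hi
  rw [hfg this.1, hfg this.2]

/-- Integration by parts against a test function. -/
theorem integral_mul_deriv_of_absolutelyContinuous {a b : ℝ} (hab : a ≤ b) {U φ : ℝ → ℝ}
    (hU : AbsolutelyContinuousOnInterval U a b) (hφ : IsTest a b φ) :
    ∫ y in Ioo a b, U y * deriv φ y = -∫ y in Ioo a b, deriv U y * φ y := by
  have h := hU.integral_mul_deriv_eq_deriv_mul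
    (g := φ) (hφ.contDiff.of_le (by simp)).contDiffOn.absolutelyContinuousOnInterval
  rw [hφ.eq_zero (x := a) (by simp), hφ.eq_zero (x := b) (by simp)] at h
  rw [intervalIntegral.integral_of_le hab, intervalIntegral.integral_of_le hab,
    integral_Ioc_eq_integral_Ioo, integral_Ioc_eq_integral_Ioo] at h
  simpa using h

theorem HasWeakDerivOn.of_absolutelyContinuous {a b : ℝ} (hab : a ≤ b) {U g : ℝ → ℝ}
    (hU : AbsolutelyContinuousOnInterval U a b)
    (hg : ∀ᵐ y ∂(volume.restrict (Ioo a b)), deriv U y = g y) :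
    HasWeakDerivOn a b U g := by
  have h1 : IntegrableOn U (Ioo a b) := by
    have := hU.continuousOn.integrableOn_compact (μ := volume) isCompact_uIcc
    rw [uIcc_of_le hab] at this
    exact this.mono_set Ioo_subset_Icc_self
  have h2 : IntegrableOn (deriv U) (Ioo a b) :=
    ((intervalIntegrable_iff_integrableOn_Ioc_of_le hab).1
      hU.intervalIntegrable_deriv).mono_set Ioo_subset_Ioc_self
  refine ⟨h1.locallyIntegrableOn, IntegrableOn.locallyIntegrableOn (h2.congr hg), fun φ hφ1 hφ2 hφ3 => ?_⟩
  rw [integral_mul_deriv_of_absolutelyContinuous hab hU ⟨hφ1, hφ2, hφ3⟩]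
  congr 1
  refine integral_congr_ae ?_
  filter_upwards [hg] with y hy
  rw [hy]

theorem HasWeakDerivOn.congr_ae {a b : ℝ} {u v g : ℝ → ℝ} (h : HasWeakDerivOn a b u g)
    (huv : u =ᵐ[volume.restrict (Ioo a b)] v) (hv : IntegrableOn v (Ioo a b)) :
    HasWeakDerivOn a b v g := by
  refine ⟨hv.locallyIntegrableOn, h.2.1, fun φ h1 h2 h3 => ?_⟩
  rw [← h.2.2 φ h1 h2 h3]
  refine integral_congr_ae ?_
  filter_upwards [huv] with y hy
  rw [hy]

theorem HasWeakDerivOn.sub {a b : ℝ} {u v g k : ℝ → ℝ} (h : HasWeakDerivOn a b u g)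
    (h' : HasWeakDerivOn a b v k) (hu : IntegrableOn u (Ioo a b)) (hv : IntegrableOn v (Ioo a b))
    (hg : IntegrableOn g (Ioo a b)) (hk : IntegrableOn k (Ioo a b)) :
    HasWeakDerivOn a b (fun y => u y - v y) (fun y => g y - k y) := by
  refine ⟨(hu.sub hv).locallyIntegrableOn, (hg.sub hk).locallyIntegrableOn, fun φ h1 h2 h3 => ?_⟩
  have hφ : IsTest a b φ := ⟨h1, h2, h3⟩
  simp only [sub_mul]
  rw [integral_sub (hφ.integrable_mul_deriv hu) (hφ.integrable_mul_deriv hv),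
    integral_sub (hφ.integrable_mul hg) (hφ.integrable_mul hk), h.2.2 φ h1 h2 h3,
    h'.2.2 φ h1 h2 h3]
  ring

/-- An integrable function with an integrable weak derivative is almost everywhere equal to
a primitive of the latter. -/
theorem HasWeakDerivOn.exists_eq_primitive {a b : ℝ} (hab : a < b) {u g : ℝ → ℝ}
    (h : HasWeakDerivOn a b u g) (hu : IntegrableOn u (Ioo a b)) (hg : IntegrableOn g (Ioo a b)) :
    AbsolutelyContinuousOnInterval (fun y => ∫ s in a..y, g s) a b ∧
    ∃ c, ∀ᵐ y ∂(volume.restrict (Ioo a b)), u y = c + ∫ s in a..y, g s := by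
  have hgi : IntervalIntegrable g volume a b :=
    (intervalIntegrable_iff_integrableOn_Ioo_of_le hab.le).2 hg
  have hac := hgi.absolutelyContinuousOnInterval_intervalIntegral (c := a) (by simp)
  have hGi : IntegrableOn (fun y => ∫ s in a..y, g s) (Ioo a b) := by
    have := hac.continuousOn.integrableOn_compact (μ := volume) isCompact_uIcc
    rw [uIcc_of_le hab.le] at this
    exact this.mono_set Ioo_subset_Icc_self
  refine ⟨hac, ?_⟩
  -- The difference between `u` and the primitive of `g` has weak derivative zero.
  obtain ⟨c, hc⟩ := ae_eq_const_of_integral_mul_deriv_eq_zero hab (hu.sub hGi) (by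
    intro ψ hψ
    have e := integral_mul_deriv_of_absolutelyContinuous hab.le hac hψ
    have e' : ∫ y in Ioo a b, deriv (fun y => ∫ s in a..y, g s) y * ψ y =
        ∫ y in Ioo a b, g y * ψ y := by
      refine integral_congr_ae ?_
      rw [EventuallyEq, ae_restrict_iff' measurableSet_Ioo]
      filter_upwards [hgi.ae_hasDerivAt_integral] with y hy hy'
      rw [(hy (by rw [uIcc_of_le hab.le]; exact Ioo_subset_Icc_self hy') a (by simp)).deriv]
    simp only [Pi.sub_apply, sub_mul]
    rw [integral_sub (hψ.integrable_mul_deriv hu) (hψ.integrable_mul_deriv hGi), e, e',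
      h.2.2 ψ hψ.1 hψ.2 hψ.3]
    ring)
  refine ⟨c, ?_⟩
  filter_upwards [hc] with y hy
  simp only [Pi.sub_apply] at hy
  linarith

theorem eqOn_Icc_of_ae_eq_Ioo {a b : ℝ} (hab : a < b) {f g : ℝ → ℝ}
    (h : ∀ᵐ y ∂(volume.restrict (Ioo a b)), f y = g y) (hf : ContinuousOn f (Icc a b))
    (hg : ContinuousOn g (Icc a b)) : EqOn f g (Icc a b) := by
  refine Measure.eqOn_Icc_of_ae_eq volume hab.ne ?_ hf hg
  rwa [EventuallyEq, ← Measure.restrict_congr_set Ioo_ae_eq_Icc]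

/-- A continuous function with an integrable weak derivative is absolutely continuous, and the weak
derivative is the classical one almost everywhere. -/
theorem HasWeakDerivOn.absolutelyContinuous {a b : ℝ} (hab : a < b) {u g : ℝ → ℝ}
    (h : HasWeakDerivOn a b u g) (hu : ContinuousOn u (Icc a b)) (hg : IntegrableOn g (Ioo a b)) :
    AbsolutelyContinuousOnInterval u a b ∧
    ∀ᵐ y ∂(volume.restrict (Ioo a b)), HasDerivAt u (g y) y := by
  obtain ⟨hac, c, hc⟩ := h.exists_eq_primitive hab
    ((hu.integrableOn_compact isCompact_Icc).mono_set Ioo_subset_Icc_self) hg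
  have hac' := hac.const_add c
  have heq := eqOn_Icc_of_ae_eq_Ioo hab hc hu (by simpa [uIcc_of_le hab.le] using hac'.continuousOn)
  refine ⟨hac'.congr_of_eqOn (by rw [uIcc_of_le hab.le]; exact heq.symm), ?_⟩
  have hgi : IntervalIntegrable g volume a b :=
    (intervalIntegrable_iff_integrableOn_Ioo_of_le hab.le).2 hg
  rw [ae_restrict_iff' measurableSet_Ioo]
  filter_upwards [hgi.ae_hasDerivAt_integral] with y hy hy'
  have h1 := (hy (by rw [uIcc_of_le hab.le]; exact Ioo_subset_Icc_self hy') a (by simp)).const_add c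
  refine h1.congr_of_eventuallyEq ?_
  filter_upwards [Ioo_mem_nhds hy'.1 hy'.2] with z hz
  exact heq (Ioo_subset_Icc_self hz)

/-- Lebesgue measure on `(0, b)`. -/
abbrev volIoo (b : ℝ) : Measure ℝ := volume.restrict (Ioo 0 b)

theorem volIoo_prod (l T : ℝ) :
    (volIoo l).prod (volIoo T) = volume.restrict (Ioo 0 l ×ˢ Ioo 0 T) := by
  rw [Measure.prod_restrict, Measure.volume_eq_prod]

/-! ### The fundamental theorem of calculus in time -/

theorem integrable_mul_prod {l T : ℝ} {h : ℝ × ℝ → ℝ}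
    (hh : Integrable h ((volIoo l).prod (volIoo T))) {η ψ : ℝ → ℝ} (hη : Continuous η)
    (hψ : Continuous ψ) (hηb : ∃ C, ∀ x, ‖η x‖ ≤ C) (hψb : ∃ C, ∀ x, ‖ψ x‖ ≤ C) :
    Integrable (fun z : ℝ × ℝ => h z * (η z.1 * ψ z.2)) ((volIoo l).prod (volIoo T)) := by
  obtain ⟨C, hC⟩ := hηb
  obtain ⟨D, hD⟩ := hψb
  refine hh.mul_bdd (c := C * D) (by fun_prop) (ae_of_all _ fun z => ?_)
  rw [norm_mul]
  exact mul_le_mul (hC _) (hD _) (norm_nonneg _) ((norm_nonneg _).trans (hC z.1))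

/-- On a bounded interval `L²` convergence of the slices implies `L¹` convergence, and `η` is
bounded. Continuity up to the endpoints is what later turns identities for almost every time into
identities at every time, `T` included. -/
theorem continuousOn_integral_mul {l T : ℝ} {u : ℝ → ℝ → ℝ} {η : ℝ → ℝ} (hη : Continuous η)
    (hηb : ∃ C, ∀ x, ‖η x‖ ≤ C)
    (hs : ∀ t ∈ Icc 0 T, MemLp (fun y => u y t) 2 (volIoo l))
    (hc : ∀ t₀ ∈ Icc 0 T, Tendsto (fun t => eLpNorm (fun y => u y t - u y t₀) 2 (volIoo l))
      (𝓝[Icc 0 T] t₀) (𝓝 0)) :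
    ContinuousOn (fun t => ∫ y, u y t * η y ∂(volIoo l)) (Icc 0 T) := by
  intro t₀ ht₀
  obtain ⟨C, hC⟩ := hηb
  have hint : ∀ t ∈ Icc 0 T, Integrable (fun y => u y t * η y) (volIoo l) := fun t ht =>
    ((hs t ht).integrable one_le_two).mul_bdd hη.aestronglyMeasurable (ae_of_all _ hC)
  refine tendsto_integral_of_L1' _ (hint t₀ ht₀).1
    (eventually_nhdsWithin_of_forall hint) ?_
  have h1 : ∀ t ∈ Icc 0 T, eLpNorm ((fun y => u y t * η y) - fun y => u y t₀ * η y) 1 (volIoo l) ≤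
      ENNReal.ofReal C * (eLpNorm (fun y => u y t - u y t₀) 2 (volIoo l) *
        (volIoo l) univ ^ (1 / (1 : ENNReal).toReal - 1 / (2 : ENNReal).toReal)) := by
    intro t ht
    refine (eLpNorm_le_mul_eLpNorm_of_ae_le_mul (g := fun y => u y t - u y t₀) (c := C)
      (ae_of_all _ fun y => ?_) 1).trans ?_
    · simp only [Pi.sub_apply, ← sub_mul, norm_mul]
      rw [mul_comm]
      exact mul_le_mul_of_nonneg_right (hC y) (norm_nonneg _)
    · gcongr
      exact eLpNorm_le_eLpNorm_mul_rpow_measure_univ one_le_two ((hs t ht).1.sub (hs t₀ ht₀).1)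
  refine tendsto_of_tendsto_of_tendsto_of_le_of_le' tendsto_const_nhds ?_
    (Eventually.of_forall fun _ => zero_le) (eventually_nhdsWithin_of_forall h1)
  have h2 : (volIoo l) univ ^ (1 / (1 : ENNReal).toReal - 1 / (2 : ENNReal).toReal) ≠ ⊤ :=
    ENNReal.rpow_ne_top_of_nonneg (by norm_num) (measure_ne_top _ _)
  have h3 := ENNReal.Tendsto.const_mul (a := ENNReal.ofReal C)
    (ENNReal.Tendsto.mul_const (hc t₀ ht₀) (Or.inr h2)) (Or.inr ENNReal.ofReal_ne_top)
  simpa using h3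

/-- Testing with the product `η(y) ψ(t)` and applying Fubini reduces the weak time derivative on the
rectangle to one variable. -/
theorem hasWeakDerivOn_integral_mul {l T : ℝ} {u g : ℝ → ℝ → ℝ}
    (hu : Integrable (fun z : ℝ × ℝ => u z.1 z.2) ((volIoo l).prod (volIoo T)))
    (hg : Integrable (fun z : ℝ × ℝ => g z.1 z.2) ((volIoo l).prod (volIoo T)))
    (hw : ∀ φ : ℝ × ℝ → ℝ, ContDiff ℝ ∞ φ → HasCompactSupport φ →
      tsupport φ ⊆ Ioo 0 l ×ˢ Ioo 0 T →
      ∫ z, u z.1 z.2 * deriv (fun s => φ (z.1, s)) z.2 ∂((volIoo l).prod (volIoo T)) =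
        - ∫ z, g z.1 z.2 * φ z ∂((volIoo l).prod (volIoo T)))
    {η : ℝ → ℝ} (hη : IsTest 0 l η) :
    IntegrableOn (fun t => ∫ y, u y t * η y ∂(volIoo l)) (Ioo 0 T) ∧
    IntegrableOn (fun t => ∫ y, g y t * η y ∂(volIoo l)) (Ioo 0 T) ∧
    HasWeakDerivOn 0 T (fun t => ∫ y, u y t * η y ∂(volIoo l))
      (fun t => ∫ y, g y t * η y ∂(volIoo l)) := by
  have aux : ∀ {h : ℝ → ℝ → ℝ},
      Integrable (fun z : ℝ × ℝ => h z.1 z.2) ((volIoo l).prod (volIoo T)) →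
      IntegrableOn (fun t => ∫ y, h y t * η y ∂(volIoo l)) (Ioo 0 T) := by
    intro h hh
    have := (integrable_mul_prod hh hη.continuous continuous_const hη.exists_bound
      ⟨_, fun x => le_refl ‖(1 : ℝ)‖⟩).integral_prod_right
    simp only [mul_one] at this
    exact this
  have swap : ∀ {h : ℝ → ℝ → ℝ} {ψ : ℝ → ℝ},
      Integrable (fun z : ℝ × ℝ => h z.1 z.2) ((volIoo l).prod (volIoo T)) →
      Continuous ψ → (∃ C, ∀ x, ‖ψ x‖ ≤ C) →
      ∫ z, h z.1 z.2 * (η z.1 * ψ z.2) ∂((volIoo l).prod (volIoo T)) =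
        ∫ t in Ioo 0 T, (∫ y, h y t * η y ∂(volIoo l)) * ψ t := by
    intro h ψ hh hψ hψb
    rw [integral_prod_symm _ (integrable_mul_prod hh hη.continuous hψ hη.exists_bound hψb)]
    congr 1
    ext t
    rw [← integral_mul_const]
    simp only [mul_assoc]
  refine ⟨aux hu, aux hg, (aux hu).locallyIntegrableOn, (aux hg).locallyIntegrableOn, ?_⟩
  intro ψ h1 h2 h3
  have hψ : IsTest 0 T ψ := ⟨h1, h2, h3⟩
  have hK : IsCompact (tsupport η ×ˢ tsupport ψ) :=
    hη.hasCompactSupport.isCompact.prod hψ.hasCompactSupport.isCompact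
  have hsub : tsupport (fun z : ℝ × ℝ => η z.1 * ψ z.2) ⊆ tsupport η ×ˢ tsupport ψ := by
    refine closure_minimal (fun z hz => ?_) hK.isClosed
    rw [Function.mem_support] at hz
    exact ⟨subset_tsupport _ (left_ne_zero_of_mul hz), subset_tsupport _ (right_ne_zero_of_mul hz)⟩
  have h4 := hw (fun z => η z.1 * ψ z.2)
    ((hη.contDiff.comp contDiff_fst).mul (h1.comp contDiff_snd))
    (HasCompactSupport.of_support_subset_isCompact hK ((subset_tsupport _).trans hsub))
    (hsub.trans (prod_mono hη.tsupport_subset h3))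
  simp only [deriv_const_mul_field'] at h4
  rw [swap hu hψ.continuous_deriv hψ.exists_bound_deriv,
    swap hg hψ.continuous hψ.exists_bound] at h4
  exact h4

/-- Paired with a test function `η` in `y`, the function `u` is continuous in time and has an
integrable weak derivative, so it equals a primitive at every time. Comparing the values at `t` and
`T` eliminates the constant, and `η` is arbitrary. -/
theorem ae_eq_sub_integral {l T : ℝ} (hT : 0 < T) {u g : ℝ → ℝ → ℝ}
    (hu : Integrable (fun z : ℝ × ℝ => u z.1 z.2) ((volIoo l).prod (volIoo T)))
    (hg : Integrable (fun z : ℝ × ℝ => g z.1 z.2) ((volIoo l).prod (volIoo T)))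
    (hw : ∀ φ : ℝ × ℝ → ℝ, ContDiff ℝ ∞ φ → HasCompactSupport φ →
      tsupport φ ⊆ Ioo 0 l ×ˢ Ioo 0 T →
      ∫ z, u z.1 z.2 * deriv (fun s => φ (z.1, s)) z.2 ∂((volIoo l).prod (volIoo T)) =
        - ∫ z, g z.1 z.2 * φ z ∂((volIoo l).prod (volIoo T)))
    (hs : ∀ t ∈ Icc 0 T, MemLp (fun y => u y t) 2 (volIoo l))
    (hc : ∀ t₀ ∈ Icc 0 T, Tendsto (fun t => eLpNorm (fun y => u y t - u y t₀) 2 (volIoo l))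
      (𝓝[Icc 0 T] t₀) (𝓝 0)) {t : ℝ} (ht : t ∈ Icc 0 T) :
    ∀ᵐ y ∂(volIoo l), u y t = u y T - ∫ s in t..T, g y s := by
  have hTT : T ∈ Icc 0 T := ⟨hT.le, le_rfl⟩
  have hle : volume.restrict (Ioc t T) ≤ volIoo T := by
    rw [← Measure.restrict_congr_set (Ioo_ae_eq_Ioc (a := t) (b := T))]
    exact Measure.restrict_mono (Ioo_subset_Ioo_left ht.1) le_rfl
  have hg' : Integrable (fun z : ℝ × ℝ => g z.1 z.2)
      ((volIoo l).prod (volume.restrict (Ioc t T))) :=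
    hg.mono_measure (Measure.prod_mono le_rfl hle)
  have hgI : Integrable (fun y => ∫ s in t..T, g y s) (volIoo l) := by
    simpa only [intervalIntegral.integral_of_le ht.2] using hg'.integral_prod_left
  have hD : IntegrableOn (fun y => u y T - u y t - ∫ s in t..T, g y s) (Ioo 0 l) :=
    (((hs T hTT).integrable one_le_two).sub ((hs t ht).integrable one_le_two)).sub hgI
  have key : ∀ᵐ y, y ∈ Ioo 0 l → u y T - u y t - ∫ s in t..T, g y s = 0 := by
    refine isOpen_Ioo.ae_eq_zero_of_integral_contDiff_smul_eq_zero hD.locallyIntegrableOn ?_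
    intro η h1 h2 h3
    have hη : IsTest 0 l η := ⟨h1, h2, h3⟩
    obtain ⟨hm, hq, hwd⟩ := hasWeakDerivOn_integral_mul hu hg hw hη
    have hcont := continuousOn_integral_mul hη.continuous hη.exists_bound hs hc
    obtain ⟨hac, c, hae⟩ := hwd.exists_eq_primitive hT hm hq
    have heq := eqOn_Icc_of_ae_eq_Ioo hT hae hcont
      (by simpa [uIcc_of_le hT.le] using (hac.const_add c).continuousOn)
    have e1 := heq ht
    have e2 := heq hTT
    have hqi : ∀ {p r : ℝ}, p ∈ Icc 0 T → r ∈ Icc 0 T →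
        IntervalIntegrable (fun t => ∫ y, g y t * η y ∂(volIoo l)) volume p r := by
      intro p r hp hr
      refine ((intervalIntegrable_iff_integrableOn_Ioo_of_le hT.le).2 hq).mono_set ?_
      rw [uIcc_of_le hT.le]
      exact ordConnected_Icc.uIcc_subset hp hr
    have e3 := intervalIntegral.integral_add_adjacent_intervals
      (hqi ⟨le_rfl, hT.le⟩ ht) (hqi ht hTT)
    -- Fubini moves the time integral inside the pairing with `η`.
    have e4 : ∫ s in t..T, ∫ y, g y s * η y ∂(volIoo l) =
        ∫ y in Ioo 0 l, (∫ s in t..T, g y s) * η y := by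
      simp only [intervalIntegral.integral_of_le ht.2]
      rw [integral_integral_swap]
      · simp only [integral_mul_const]
      · obtain ⟨C, hC⟩ := hη.exists_bound
        exact (hg'.mul_bdd (hη.continuous.comp continuous_fst).aestronglyMeasurable
          (ae_of_all _ fun z => hC z.1)).swap
    have e5 : ∫ y, η y • (u y T - u y t - ∫ s in t..T, g y s) =
        ∫ y in Ioo 0 l, (u y T * η y - u y t * η y - (∫ s in t..T, g y s) * η y) := by
      rw [← setIntegral_eq_integral_of_forall_compl_eq_zero (s := Ioo 0 l) fun x hx => by
        rw [hη.eq_zero hx, zero_smul]]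
      congr 1; ext y; simp only [smul_eq_mul]; ring
    have iT := hη.integrable_mul ((hs T hTT).integrable one_le_two)
    have it := hη.integrable_mul ((hs t ht).integrable one_le_two)
    have iTt : IntegrableOn (fun y => u y T * η y - u y t * η y) (Ioo 0 l) := iT.sub it
    rw [e5, integral_sub iTt (hη.integrable_mul hgI), integral_sub iT it, ← e4]
    simp only at e1 e2
    linarith
  rw [ae_restrict_iff' measurableSet_Ioo]
  filter_upwards [key] with y hy hy'
  linarith [hy hy']

/-! ### The energy identity -/

/-- Squaring removes the corner of the positive part: at `0` both one-sided derivatives vanish. -/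
theorem hasDerivAt_sq_max_zero (x : ℝ) :
    HasDerivAt (fun s : ℝ => max s 0 ^ 2) (2 * max x 0) x := by
  rcases lt_trichotomy x 0 with h | h | h
  · rw [max_eq_right h.le, mul_zero]
    refine (hasDerivAt_const x (0 : ℝ)).congr_of_eventuallyEq ?_
    filter_upwards [Iio_mem_nhds h] with s hs
    simp [max_eq_right (le_of_lt (show s < 0 from hs))]
  · subst h
    rw [← hasDerivWithinAt_univ, ← Iic_union_Ici (a := (0 : ℝ))]
    have h1 : HasDerivWithinAt (fun s : ℝ => max s 0 ^ 2) (2 * max 0 0) (Iic 0) 0 := by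
      refine ((hasDerivAt_const (0 : ℝ) (0 : ℝ)).hasDerivWithinAt.congr (fun s hs => ?_) ?_).congr_deriv
        (by simp)
      · simp [max_eq_right (show s ≤ 0 from hs)]
      · simp
    have h2 : HasDerivWithinAt (fun s : ℝ => max s 0 ^ 2) (2 * max 0 0) (Ici 0) 0 := by
      refine ((hasDerivAt_pow 2 (0 : ℝ)).hasDerivWithinAt.congr (fun s hs => ?_) ?_).congr_deriv
        (by simp)
      · simp [max_eq_left (show 0 ≤ s from hs)]
      · simp
    exact h1.union h2
  · rw [max_eq_left h.le]
    refine ((hasDerivAt_pow 2 x).congr_of_eventuallyEq ?_).congr_deriv (by simp)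
    filter_upwards [Ioi_mem_nhds h] with s hs
    simp [max_eq_left (le_of_lt (show 0 < s from hs))]

/-- Chain rule along an absolutely continuous function. The variable is the lower limit of
integration, so `b - ∫ r in s..T, G r` has derivative `+G s`. -/
theorem sq_max_zero_sub_integral {T : ℝ} (hT : 0 < T) {G : ℝ → ℝ} (hG : IntegrableOn G (Ioo 0 T))
    (b : ℝ) {t : ℝ} (ht : t ∈ Icc 0 T) :
    max (b - ∫ s in t..T, G s) 0 ^ 2 =
      max b 0 ^ 2 - ∫ s in t..T, 2 * max (b - ∫ r in s..T, G r) 0 * G s := by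
  have hGi : IntervalIntegrable G volume 0 T :=
    (intervalIntegrable_iff_integrableOn_Ioo_of_le hT.le).2 hG
  have hac : AbsolutelyContinuousOnInterval (fun s => b - ∫ r in s..T, G r) 0 T := by
    have := (hGi.absolutelyContinuousOnInterval_intervalIntegral (c := T) (by simp)).const_add b
    simpa only [intervalIntegral.integral_symm _ T, sub_neg_eq_add, sub_eq_add_neg] using this
  have hac2 : AbsolutelyContinuousOnInterval (fun s => max (b - ∫ r in s..T, G r) 0 ^ 2) t T := by
    have h := hac.max_zero.fun_mul hac.max_zero
    simp only [← pow_two] at h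
    refine h.mono ?_
    rw [uIcc_of_le ht.2, uIcc_of_le hT.le]
    exact Icc_subset_Icc_left ht.1
  have h := hac2.integral_deriv_eq_sub
  simp only [intervalIntegral.integral_same, sub_zero] at h
  have h' : ∫ s in t..T, deriv (fun s => max (b - ∫ r in s..T, G r) 0 ^ 2) s =
      ∫ s in t..T, 2 * max (b - ∫ r in s..T, G r) 0 * G s := by
    refine intervalIntegral.integral_congr_ae ?_
    filter_upwards [hGi.ae_hasDerivAt_integral] with s hs hs'
    have hmem : s ∈ uIcc 0 T := by
      rw [uIoc_of_le ht.2] at hs'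
      rw [uIcc_of_le hT.le]
      exact ⟨ht.1.trans hs'.1.le, hs'.2⟩
    have hd : HasDerivAt (fun s => b - ∫ r in s..T, G r) (G s) s := by
      have := (hs hmem T (by simp)).const_add b
      simpa only [intervalIntegral.integral_symm _ T, sub_neg_eq_add, sub_eq_add_neg] using this
    exact ((hasDerivAt_sq_max_zero _).comp s hd).deriv
  rw [h'] at h
  linarith

/-- Cauchy-Schwarz, by integrating the nonnegative square `(T|f| - a)² / T` with `a = ∫ |f|`. -/
theorem sq_integral_abs_le {T : ℝ} (hT : 0 < T) {f : ℝ → ℝ} (hf : MemLp f 2 (volIoo T)) :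
    (∫ s, |f s| ∂(volIoo T)) ^ 2 ≤ T * ∫ s, f s ^ 2 ∂(volIoo T) := by
  set a := ∫ s, |f s| ∂(volIoo T) with ha
  have h1 : Integrable (fun s => |f s|) (volIoo T) := (hf.integrable one_le_two).abs
  have h2 := hf.integrable_sq
  have h3 : 0 ≤ ∫ s, (T * f s ^ 2 - 2 * a * |f s| + a ^ 2 / T) ∂(volIoo T) := by
    refine integral_nonneg fun s => ?_
    have : T * f s ^ 2 - 2 * a * |f s| + a ^ 2 / T = (T * |f s| - a) ^ 2 / T := by
      rw [← sq_abs (f s)]; field_simp; ring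
    simp only [Pi.zero_apply, this]
    positivity
  have h5 : Integrable (fun s => T * f s ^ 2 - 2 * a * |f s|) (volIoo T) :=
    (h2.const_mul _).sub (h1.const_mul _)
  rw [integral_add h5 (integrable_const _),
    integral_sub (h2.const_mul _) (h1.const_mul _), integral_const_mul, integral_const_mul, ← ha]
    at h3
  have h4 : ∫ _, a ^ 2 / T ∂(volIoo T) = a ^ 2 := by
    simp [hT.le]
    field_simp
  rw [h4] at h3
  nlinarith

/-- Supplies an `L²` majorant in `y`, uniform in `t`, of the integrals of `G` over `(t, T)`. -/
theorem memLp_integral_abs {l T : ℝ} (hT : 0 < T) {G : ℝ × ℝ → ℝ} (hGm : StronglyMeasurable G)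
    (hG : MemLp G 2 ((volIoo l).prod (volIoo T))) :
    MemLp (fun y => ∫ s, |G (y, s)| ∂(volIoo T)) 2 (volIoo l) := by
  have hm : AEStronglyMeasurable (fun y => ∫ s, |G (y, s)| ∂(volIoo T)) (volIoo l) :=
    (hG.1.norm).integral_prod_right'
  rw [memLp_two_iff_integrable_sq hm]
  have h1 : Integrable (fun y => ∫ s, G (y, s) ^ 2 ∂(volIoo T)) (volIoo l) :=
    hG.integrable_sq.integral_prod_left
  refine (h1.const_mul T).mono' (hm.pow 2) ?_
  filter_upwards [hG.integrable_sq.prod_right_ae] with y hy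
  rw [Real.norm_of_nonneg (sq_nonneg _)]
  refine sq_integral_abs_le hT ?_
  rwa [memLp_two_iff_integrable_sq]
  exact (hGm.comp_measurable measurable_prodMk_left).aestronglyMeasurable

theorem abs_integral_le {T : ℝ} {G : ℝ → ℝ} (hG : IntegrableOn G (Ioo 0 T)) {t : ℝ}
    (ht : t ∈ Icc 0 T) : |∫ s in t..T, G s| ≤ ∫ s, |G s| ∂(volIoo T) := by
  rw [intervalIntegral.integral_of_le ht.2, integral_Ioc_eq_integral_Ioo]
  refine abs_integral_le_integral_abs.trans ?_
  exact setIntegral_mono_set (Integrable.abs hG) (ae_of_all _ fun _ => abs_nonneg _)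
    (Ioo_subset_Ioo_left ht.1).eventuallyLE

/-- The moving domain of integration becomes the indicator of a measurable set of triples, which
leaves an integral over a fixed domain depending on a parameter. -/
theorem stronglyMeasurable_integral {T : ℝ} {G : ℝ × ℝ → ℝ} (hGm : StronglyMeasurable G) :
    StronglyMeasurable (fun z : ℝ × ℝ => ∫ s in Ioc z.2 T, G (z.1, s)) := by
  have h1 : StronglyMeasurable (fun p : (ℝ × ℝ) × ℝ =>
      {q : (ℝ × ℝ) × ℝ | q.1.2 < q.2 ∧ q.2 ≤ T}.indicator (fun q => G (q.1.1, q.2)) p) := by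
    refine StronglyMeasurable.indicator
      (hGm.comp_measurable (g := fun q : (ℝ × ℝ) × ℝ => (q.1.1, q.2)) (by fun_prop)) ?_
    exact (measurableSet_lt (f := fun q : (ℝ × ℝ) × ℝ => q.1.2) (g := fun q => q.2)
      (by fun_prop) (by fun_prop)).inter (measurableSet_le (f := fun q : (ℝ × ℝ) × ℝ => q.2)
      (g := fun _ => T) (by fun_prop) (by fun_prop))
  have h2 := h1.integral_prod_right' (ν := (volume : Measure ℝ))
  convert h2 using 2 with z
  rw [← integral_indicator measurableSet_Ioc]
  rfl

/-- The energy identity for a function which is absolutely continuous in time. -/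
theorem energy_identity {l T : ℝ} (hT : 0 < T) {b : ℝ → ℝ} {G : ℝ × ℝ → ℝ} {φ : ℝ → ℝ}
    (hb : MemLp b 2 (volIoo l)) (hGm : StronglyMeasurable G)
    (hG : MemLp G 2 ((volIoo l).prod (volIoo T))) (hφ : AEStronglyMeasurable φ (volIoo l)) {C : ℝ}
    (hC : ∀ᵐ y ∂(volIoo l), ‖φ y‖ ≤ C) :
    IntegrableOn (fun s => ∫ y, φ y * (2 * max (b y - ∫ r in s..T, G (y, r)) 0 * G (y, s))
      ∂(volIoo l)) (Ioo 0 T) ∧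
    ∀ t ∈ Icc 0 T, ∫ y, φ y * max (b y - ∫ s in t..T, G (y, s)) 0 ^ 2 ∂(volIoo l) =
      ∫ y, φ y * max (b y) 0 ^ 2 ∂(volIoo l) -
        ∫ s in t..T, ∫ y, φ y * (2 * max (b y - ∫ r in s..T, G (y, r)) 0 * G (y, s))
          ∂(volIoo l) := by
  have hGi : ∀ᵐ y ∂(volIoo l), IntegrableOn (fun s => G (y, s)) (Ioo 0 T) :=
    (hG.integrable one_le_two).prod_right_ae
  have hint : Integrable (fun z : ℝ × ℝ =>
      φ z.1 * (2 * max (b z.1 - ∫ r in z.2..T, G (z.1, r)) 0 * G z))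
      ((volIoo l).prod (volIoo T)) := by
    -- The integrand is dominated by `2C` times the product of two `L²` functions on the rectangle:
    -- this majorant, constant in time, and `‖G‖`.
    have hB : MemLp (fun y => |b y| + ∫ s, |G (y, s)| ∂(volIoo T)) 2 (volIoo l) :=
      hb.abs.add (memLp_integral_abs hT hGm hG)
    have h1 : Integrable (fun z : ℝ × ℝ =>
        (|b z.1| + ∫ s, |G (z.1, s)| ∂(volIoo T)) * ‖G z‖) ((volIoo l).prod (volIoo T)) :=
      (hB.comp_fst (volIoo T)).integrable_mul hG.norm
    have htm : ∀ᵐ z ∂((volIoo l).prod (volIoo T)), z.2 ∈ Icc 0 T := by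
      rw [volIoo_prod]
      filter_upwards [ae_restrict_mem (measurableSet_Ioo.prod measurableSet_Ioo)] with z hz
      exact Ioo_subset_Icc_self hz.2
    have hφz : ∀ᵐ z ∂((volIoo l).prod (volIoo T)), ‖φ z.1‖ ≤ C :=
      Measure.quasiMeasurePreserving_fst.ae hC
    have hGz : ∀ᵐ z ∂((volIoo l).prod (volIoo T)),
        IntegrableOn (fun s => G (z.1, s)) (Ioo 0 T) :=
      Measure.quasiMeasurePreserving_fst.ae hGi
    have hIm : AEStronglyMeasurable (fun z : ℝ × ℝ => ∫ r in z.2..T, G (z.1, r))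
        ((volIoo l).prod (volIoo T)) := by
      refine (stronglyMeasurable_integral (T := T) hGm).aestronglyMeasurable.congr ?_
      filter_upwards [htm] with z hz
      rw [intervalIntegral.integral_of_le hz.2]
    have hUm : AEStronglyMeasurable (fun z : ℝ × ℝ =>
        max (b z.1 - ∫ r in z.2..T, G (z.1, r)) 0) ((volIoo l).prod (volIoo T)) :=
      (hb.1.comp_fst.sub hIm).sup aestronglyMeasurable_const
    refine (h1.const_mul (C * 2)).mono' (hφ.comp_fst.mul ((hUm.const_mul 2).mul hG.1)) ?_
    filter_upwards [htm, hφz, hGz] with z hz1 hz2 hz3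
    rw [norm_mul, norm_mul, norm_mul, Real.norm_ofNat]
    have h2 : ‖max (b z.1 - ∫ r in z.2..T, G (z.1, r)) 0‖ ≤
        |b z.1| + ∫ s, |G (z.1, s)| ∂(volIoo T) := by
      rw [Real.norm_of_nonneg (le_max_right _ _)]
      refine max_le ?_ (add_nonneg (abs_nonneg _) (integral_nonneg fun _ => abs_nonneg _))
      have h3 := abs_integral_le hz3 hz1
      have h4 := le_abs_self (b z.1)
      have h5 := neg_abs_le (∫ r in z.2..T, G (z.1, r))
      linarith
    calc ‖φ z.1‖ * (2 * ‖max (b z.1 - ∫ r in z.2..T, G (z.1, r)) 0‖ * ‖G z‖)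
        ≤ C * (2 * (|b z.1| + ∫ s, |G (z.1, s)| ∂(volIoo T)) * ‖G z‖) :=
          mul_le_mul hz2 (by gcongr) (by positivity) ((norm_nonneg _).trans hz2)
      _ = _ := by ring
  refine ⟨hint.integral_prod_right, fun t ht => ?_⟩
  have hle : volume.restrict (Ioc t T) ≤ volIoo T := by
    rw [← Measure.restrict_congr_set (Ioo_ae_eq_Ioc (a := t) (b := T))]
    exact Measure.restrict_mono (Ioo_subset_Ioo_left ht.1) le_rfl
  have hint' := hint.mono_measure (Measure.prod_mono (le_refl (volIoo l)) hle)
  have hb2 : Integrable (fun y => φ y * max (b y) 0 ^ 2) (volIoo l) := by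
    have h0 : Integrable (fun y => max (b y) 0 ^ 2) (volIoo l) := by
      refine hb.integrable_sq.mono' ((hb.1.sup aestronglyMeasurable_const).pow 2)
        (ae_of_all _ fun y => ?_)
      rw [Real.norm_of_nonneg (sq_nonneg _), ← sq_abs (b y)]
      exact pow_le_pow_left₀ (le_max_right _ _) (max_le (le_abs_self _) (abs_nonneg _)) 2
    exact h0.bdd_mul hφ hC
  have hswap := integral_integral_swap (f := fun y s =>
    φ y * (2 * max (b y - ∫ r in s..T, G (y, r)) 0 * G (y, s))) hint'
  simp only [intervalIntegral.integral_of_le ht.2]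
  rw [← hswap, ← integral_sub hb2 hint'.integral_prod_left]
  refine integral_congr_ae ?_
  filter_upwards [hGi] with y hy
  have h := sq_max_zero_sub_integral hT hy (b y) ht
  simp only [intervalIntegral.integral_of_le ht.2] at h
  rw [h, integral_const_mul]
  ring

section

/-! ### Geometry of the network -/

namespace Network

variable {n : ℕ} {I A : Type*} (N : Network n I A)

theorem length_pos (α : A) : 0 < N.length α :=
  dist_pos.2 fun h => N.src_ne_tgt α (N.vertex_injective h)

theorem param_zero (α : A) : N.param α 0 = N.vertex (N.src α) := by simp [param]

theorem param_length (α : A) : N.param α (N.length α) = N.vertex (N.tgt α) := by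
  simp [param, (N.length_pos α).ne']

theorem continuous_param (α : A) : Continuous (N.param α) := by
  unfold param
  exact AffineMap.lineMap_continuous.comp (continuous_id.div_const _)

theorem param_injective (α : A) : Function.Injective (N.param α) := by
  intro y z h
  have h' := AffineMap.lineMap_injective ℝ
    (fun h => N.src_ne_tgt α (N.vertex_injective h)) h
  have := (N.length_pos α).ne'
  field_simp at h'
  exact h'

theorem param_mem_edge {α : A} {y : ℝ} (hy : y ∈ Icc 0 (N.length α)) :
    N.param α y ∈ N.edge α := by
  rw [edge, segment_eq_image_lineMap]
  exact ⟨y / N.length α, ⟨div_nonneg hy.1 (N.length_pos α).le,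
    div_le_one_of_le₀ hy.2 (N.length_pos α).le⟩, rfl⟩

theorem exists_param_eq {α : A} {x : EuclideanSpace ℝ (Fin n)} (hx : x ∈ N.edge α) :
    ∃ y ∈ Icc 0 (N.length α), N.param α y = x := by
  rw [edge, segment_eq_image_lineMap] at hx
  obtain ⟨s, hs, rfl⟩ := hx
  have h := N.length_pos α
  refine ⟨s * N.length α, ⟨by have := hs.1; positivity, by nlinarith [hs.2]⟩, ?_⟩
  rw [param, mul_div_cancel_right₀ _ h.ne']

theorem edge_subset_carrier (α : A) : N.edge α ⊆ N.carrier := subset_iUnion N.edge α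

theorem mapsTo_param (α : A) : MapsTo (N.param α) (Icc 0 (N.length α)) N.carrier :=
  fun _ hy => N.edge_subset_carrier α (N.param_mem_edge hy)

theorem continuousOn_pull {v : EuclideanSpace ℝ (Fin n) → ℝ} (hv : ContinuousOn v N.carrier)
    (α : A) : ContinuousOn (N.pull v α) (Icc 0 (N.length α)) :=
  hv.comp (N.continuous_param α).continuousOn (N.mapsTo_param α)

theorem param_ne_vertex {α : A} {y : ℝ} (hy : y ∈ Ioo 0 (N.length α)) (i : I) :
    N.param α y ≠ N.vertex i := by
  intro h
  have hi := N.eq_src_or_eq_tgt i α (h ▸ N.param_mem_edge (Ioo_subset_Icc_self hy))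
  rcases hi with rfl | rfl
  · rw [← N.param_zero] at h
    exact hy.1.ne' (N.param_injective α h)
  · rw [← N.param_length] at h
    exact hy.2.ne (N.param_injective α h)

/-- Distinct edges meet at most in a vertex, and interior points of edges are not vertices. This
makes gluing along open edges well defined. -/
theorem param_eq_param {α β : A} {y z : ℝ} (hy : y ∈ Ioo 0 (N.length α))
    (hz : z ∈ Ioo 0 (N.length β)) (h : N.param α y = N.param β z) : α = β ∧ y = z := by
  by_cases hαβ : α = β
  · subst hαβ
    exact ⟨rfl, N.param_injective α h⟩
  · have hmem : N.param α y ∈ N.edge α ∩ N.edge β :=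
      ⟨N.param_mem_edge (Ioo_subset_Icc_self hy), h ▸ N.param_mem_edge (Ioo_subset_Icc_self hz)⟩
    rcases N.inter α β hαβ with h' | ⟨i, h'⟩
    · exact absurd (h' ▸ hmem : _ ∈ (∅ : Set _)) (notMem_empty _)
    · exact absurd (h' ▸ hmem : _ ∈ ({N.vertex i} : Set _)) (N.param_ne_vertex hy i)

/-- A family of functions on the open edges glues to a function on the network. -/
theorem exists_glue (φ : A → ℝ → ℝ) (hφ : ∀ α, ∀ y ∈ Ioo 0 (N.length α), 0 ≤ φ α y) :
    ∃ w : EuclideanSpace ℝ (Fin n) → ℝ, (∀ x, 0 ≤ w x) ∧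
      ∀ α, ∀ y ∈ Ioo 0 (N.length α), N.pull w α y = φ α y := by
  classical
  let P : EuclideanSpace ℝ (Fin n) → A × ℝ → Prop := fun x p =>
    p.2 ∈ Ioo 0 (N.length p.1) ∧ N.param p.1 p.2 = x
  -- The value `0` at the vertices is harmless: membership in `W` only involves the continuous
  -- representatives on the edges, whose endpoint values may differ from edge to edge.
  refine ⟨fun x => if h : ∃ p, P x p then φ h.choose.1 h.choose.2 else 0, fun x => ?_,
    fun α y hy => ?_⟩
  · dsimp only
    split_ifs with h
    · exact hφ _ _ h.choose_spec.1
    · exact le_rfl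
  · have h : ∃ p, P (N.param α y) p := ⟨(α, y), hy, rfl⟩
    have h2 := N.param_eq_param h.choose_spec.1 hy h.choose_spec.2
    simp only [pull, dif_pos h]
    rw [h2.1, h2.2]

theorem mem_adjacent [Fintype A] {i : I} {α : A} :
    α ∈ N.adjacent i ↔ N.vertex i ∈ N.edge α := by
  simp [adjacent]

theorem eq_src_or_tgt_of_mem_adjacent [Fintype A] {i : I} {α : A} (h : α ∈ N.adjacent i) :
    i = N.src α ∨ i = N.tgt α :=
  N.eq_src_or_eq_tgt i α (N.mem_adjacent.1 h)

theorem mem_adjacent_src [Fintype A] (α : A) : α ∈ N.adjacent (N.src α) :=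
  N.mem_adjacent.2 (left_mem_segment ℝ _ _)

theorem mem_adjacent_tgt [Fintype A] (α : A) : α ∈ N.adjacent (N.tgt α) :=
  N.mem_adjacent.2 (right_mem_segment ℝ _ _)

theorem param_coord [Fintype A] {i : I} {α : A} (h : α ∈ N.adjacent i) :
    N.param α (N.coord α i) = N.vertex i := by
  rcases N.eq_src_or_tgt_of_mem_adjacent h with rfl | rfl
  · simp [coord, param_zero]
  · simp [coord, param_length, (N.src_ne_tgt α).symm]

/-- The function which is affine on the edge and takes the values `γ_{iα}` at its endpoints. -/
def weight (γ : I → A → ℝ) (α : A) (y : ℝ) : ℝ :=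
  (1 - y / N.length α) * γ (N.src α) α + y / N.length α * γ (N.tgt α) α

/-- The derivative of `weight`. -/
def weightSlope (γ : I → A → ℝ) (α : A) : ℝ :=
  (γ (N.tgt α) α - γ (N.src α) α) / N.length α

theorem hasDerivAt_weight (γ : I → A → ℝ) (α : A) (y : ℝ) :
    HasDerivAt (N.weight γ α) (N.weightSlope γ α) y := by
  unfold weight weightSlope
  have h1 := (hasDerivAt_id y).div_const (N.length α)
  have h2 := ((h1.const_sub 1).mul_const (γ (N.src α) α)).add (h1.mul_const (γ (N.tgt α) α))
  refine h2.congr_deriv ?_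
  ring

theorem continuous_weight (γ : I → A → ℝ) (α : A) : Continuous (N.weight γ α) :=
  continuous_iff_continuousAt.2 fun y => (N.hasDerivAt_weight γ α y).continuousAt

theorem contDiff_weight (γ : I → A → ℝ) (α : A) : ContDiff ℝ 1 (N.weight γ α) := by
  unfold weight
  fun_prop

theorem weight_coord [Fintype A] (γ : I → A → ℝ) {i : I} {α : A} (h : α ∈ N.adjacent i) :
    N.weight γ α (N.coord α i) = γ i α := by
  rcases N.eq_src_or_tgt_of_mem_adjacent h with rfl | rfl
  · simp [coord, weight]
  · simp [coord, weight, (N.src_ne_tgt α).symm, (N.length_pos α).ne']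

theorem min_le_weight (γ : I → A → ℝ) {α : A} {y : ℝ} (hy : y ∈ Icc 0 (N.length α)) :
    min (γ (N.src α) α) (γ (N.tgt α) α) ≤ N.weight γ α y := by
  have h0 : 0 ≤ y / N.length α := div_nonneg hy.1 (N.length_pos α).le
  have h1 : y / N.length α ≤ 1 := div_le_one_of_le₀ hy.2 (N.length_pos α).le
  unfold weight
  nlinarith [min_le_left (γ (N.src α) α) (γ (N.tgt α) α),
    min_le_right (γ (N.src α) α) (γ (N.tgt α) α)]

theorem weight_le_max (γ : I → A → ℝ) {α : A} {y : ℝ} (hy : y ∈ Icc 0 (N.length α)) :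
    N.weight γ α y ≤ max (γ (N.src α) α) (γ (N.tgt α) α) := by
  have h0 : 0 ≤ y / N.length α := div_nonneg hy.1 (N.length_pos α).le
  have h1 : y / N.length α ≤ 1 := div_le_one_of_le₀ hy.2 (N.length_pos α).le
  unfold weight
  nlinarith [le_max_left (γ (N.src α) α) (γ (N.tgt α) α),
    le_max_right (γ (N.src α) α) (γ (N.tgt α) α)]

theorem edgeTimeMeasure_eq (T : ℝ) (α : A) :
    N.edgeTimeMeasure T α = (volIoo (N.length α)).prod (volIoo T) :=
  (volIoo_prod _ _).symm

/-- An inequality between continuous functions on the network which holds almost everywhere holds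
everywhere. -/
theorem AE.le_of_continuousOn {u u' : EuclideanSpace ℝ (Fin n) → ℝ}
    {N : Network n I A} (h : N.AE fun x => u x ≤ u' x) (hu : ContinuousOn u N.carrier)
    (hu' : ContinuousOn u' N.carrier) : ∀ x ∈ N.carrier, u x ≤ u' x := by
  intro x hx
  obtain ⟨α, hα⟩ := mem_iUnion.1 hx
  obtain ⟨y, hy, rfl⟩ := N.exists_param_eq hα
  -- The inequality is recast as an equation between continuous functions, which extends from almost
  -- every point to the closed edge.
  have h1 : ∀ᵐ y ∂(volume.restrict (Ioo 0 (N.length α))),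
      max (u (N.param α y) - u' (N.param α y)) 0 = 0 := by
    filter_upwards [h α] with y hy
    exact max_eq_right (sub_nonpos.2 hy)
  have h2 := eqOn_Icc_of_ae_eq_Ioo (N.length_pos α) h1
    (((N.continuousOn_pull hu α).sub (N.continuousOn_pull hu' α)).sup continuousOn_const)
    continuousOn_const hy
  linarith [max_eq_right_iff.1 h2]

end Network

variable {n : ℕ} {I A : Type*} [Fintype A] (N : Network n I A)

theorem CoefficientAssumptions.min_pos {N : Network n I A} {μ : A → ℝ} {γ : I → A → ℝ}
    (h : CoefficientAssumptions N μ γ) (α : A) :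
    0 < min (γ (N.src α) α) (γ (N.tgt α) α) :=
  lt_min (h.gamma_pos _ α (N.mem_adjacent_src α)) (h.gamma_pos _ α (N.mem_adjacent_tgt α))

theorem CoefficientAssumptions.weight_pos {N : Network n I A} {μ : A → ℝ} {γ : I → A → ℝ}
    (h : CoefficientAssumptions N μ γ) {α : A} {y : ℝ} (hy : y ∈ Icc 0 (N.length α)) :
    0 < N.weight γ α y :=
  (h.min_pos α).trans_le (N.min_le_weight γ hy)

/-! ### The test function -/

theorem memLp_of_continuousOn {l : ℝ} {f : ℝ → ℝ} (hf : ContinuousOn f (Icc 0 l)) :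
    MemLp f 2 (volIoo l) := by
  obtain ⟨C, hC⟩ := isCompact_Icc.exists_bound_of_continuousOn hf
  refine MemLp.of_bound
    ((hf.mono Ioo_subset_Icc_self).aestronglyMeasurable measurableSet_Ioo) C ?_
  filter_upwards [ae_restrict_mem measurableSet_Ioo] with y hy
  exact hC y (Ioo_subset_Icc_self hy)

/-- The test function `φ u⁺`, where `φ` is the weight of the network. -/
theorem exists_test_function {μ : A → ℝ} {γ : I → A → ℝ} (hμγ : CoefficientAssumptions N μ γ)
    {u : EuclideanSpace ℝ (Fin n) → ℝ} (hu : ContinuousOn u N.carrier) {g : A → ℝ → ℝ}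
    (hg : ∀ α, MemLp (g α) 2 (volIoo (N.length α)))
    (hug : ∀ α, HasWeakDerivOn 0 (N.length α) (N.pull u α) (g α)) :
    ∃ (w : EuclideanSpace ℝ (Fin n) → ℝ) (w_x : A → ℝ → ℝ), MemW N γ w ∧ (∀ x, 0 ≤ w x) ∧
      (∀ α, ∀ y ∈ Ioo 0 (N.length α), N.pull w α y = N.weight γ α y * max (N.pull u α y) 0) ∧
      (∀ α, HasWeakDerivOn 0 (N.length α) (N.pull w α) (w_x α)) ∧
      (∀ α, MemLp (w_x α) 2 (volIoo (N.length α))) ∧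
      ∀ α, ∀ᵐ y ∂(volIoo (N.length α)), (N.pull u α y ≤ 0 → w_x α y = 0) ∧
        (0 < N.pull u α y →
          w_x α y = N.weightSlope γ α * N.pull u α y + N.weight γ α y * g α y) := by
  have hpos : ∀ α, ∀ y ∈ Icc 0 (N.length α), 0 < N.weight γ α y := fun α y hy => hμγ.weight_pos hy
  obtain ⟨w, hw0, hw⟩ := N.exists_glue (fun α y => N.weight γ α y * max (N.pull u α y) 0)
    fun α y hy => mul_nonneg (hpos α y (Ioo_subset_Icc_self hy)).le (le_max_right _ _)
  have hcont : ∀ α, ContinuousOn (fun y => N.weight γ α y * max (N.pull u α y) 0)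
      (Icc 0 (N.length α)) := fun α =>
    (N.continuous_weight γ α).continuousOn.mul ((N.continuousOn_pull hu α).sup continuousOn_const)
  have hac : ∀ α, AbsolutelyContinuousOnInterval (N.pull u α) 0 (N.length α) ∧
      ∀ᵐ y ∂(volIoo (N.length α)), HasDerivAt (N.pull u α) (g α y) y := fun α =>
    (hug α).absolutelyContinuous (N.length_pos α) (N.continuousOn_pull hu α)
      ((hg α).integrable one_le_two)
  have hder : ∀ α, ∀ᵐ y ∂(volIoo (N.length α)), (N.pull u α y ≤ 0 →
      deriv (fun y => N.weight γ α y * max (N.pull u α y) 0) y = 0) ∧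
        (0 < N.pull u α y → deriv (fun y => N.weight γ α y * max (N.pull u α y) 0) y =
          N.weightSlope γ α * N.pull u α y + N.weight γ α y * g α y) := by
    intro α
    filter_upwards [(hac α).2, ae_restrict_mem measurableSet_Ioo] with y hy hyI
    constructor
    · intro h
      -- The product is zero at `y` and nonnegative nearby, so `y` is a local minimum. If it is not
      -- differentiable there, `deriv` is `0` by default.
      refine IsLocalMin.deriv_eq_zero ?_
      filter_upwards [Ioo_mem_nhds hyI.1 hyI.2] with z hz
      rw [max_eq_right h, mul_zero]
      exact mul_nonneg (hpos α z (Ioo_subset_Icc_self hz)).le (le_max_right _ _)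
    · intro h
      have h1 := (N.hasDerivAt_weight γ α y).mul hy
      refine (h1.congr_of_eventuallyEq ?_).deriv
      filter_upwards [hy.continuousAt.eventually (lt_mem_nhds h)] with z hz
      simp [max_eq_left hz.le]
  have hae : ∀ α, (fun y => N.weight γ α y * max (N.pull u α y) 0)
      =ᵐ[volIoo (N.length α)] N.pull w α := by
    intro α
    filter_upwards [ae_restrict_mem measurableSet_Ioo] with y hy
    rw [hw α y hy]
  have hwd : ∀ α, HasWeakDerivOn 0 (N.length α) (N.pull w α)
      (deriv fun y => N.weight γ α y * max (N.pull u α y) 0) := by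
    intro α
    have h1 : AbsolutelyContinuousOnInterval (fun y => N.weight γ α y * max (N.pull u α y) 0)
        0 (N.length α) :=
      (N.contDiff_weight γ α).contDiffOn.absolutelyContinuousOnInterval.fun_mul (hac α).1.max_zero
    exact (HasWeakDerivOn.of_absolutelyContinuous (N.length_pos α).le h1
      (ae_of_all _ fun _ => rfl)).congr_ae (hae α)
      (((memLp_of_continuousOn (hcont α)).integrable one_le_two).congr (hae α))
  have hwm : ∀ α, MemLp (N.pull w α) 2 (volIoo (N.length α)) := fun α =>
    (memLp_congr_ae (hae α)).1 (memLp_of_continuousOn (hcont α))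
  have hxm : ∀ α, MemLp (deriv fun y => N.weight γ α y * max (N.pull u α y) 0) 2
      (volIoo (N.length α)) := by
    intro α
    have h1 : MemLp (fun y => |N.weightSlope γ α| * |N.pull u α y| +
        max (γ (N.src α) α) (γ (N.tgt α) α) * |g α y|) 2 (volIoo (N.length α)) :=
      ((memLp_of_continuousOn (N.continuousOn_pull hu α)).abs.const_mul _).add
        ((hg α).abs.const_mul _)
    refine h1.of_le (measurable_deriv _).aestronglyMeasurable ?_
    filter_upwards [hder α, ae_restrict_mem measurableSet_Ioo] with y hy hyI
    have hyI' := Ioo_subset_Icc_self hyI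
    have h2 := N.weight_le_max γ hyI'
    have h3 := hpos α y hyI'
    rw [Real.norm_eq_abs, Real.norm_eq_abs]
    refine le_trans ?_ (le_abs_self _)
    rcases le_or_gt (N.pull u α y) 0 with h | h
    · rw [hy.1 h, abs_zero]
      have := h3.trans_le h2
      positivity
    · rw [hy.2 h]
      refine (abs_add_le _ _).trans ?_
      rw [abs_mul, abs_mul, abs_of_pos h3]
      gcongr
  refine ⟨w, fun α => deriv fun y => N.weight γ α y * max (N.pull u α y) 0, ⟨fun α => ⟨hwm α, _,
    hwd α, hxm α⟩, fun α y => N.weight γ α y * max (N.pull u α y) 0, fun α => ⟨hcont α,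
    (hae α).symm⟩, ?_⟩, hw0, hw, hwd, hxm, hder⟩
  intro i α hα β hβ
  -- At `ν_i` the weight equals `γ_{iα}`; after division only `u⁺(ν_i)` remains, which is the same
  -- for every adjacent edge.
  simp only [Network.pull, N.param_coord hα, N.param_coord hβ, N.weight_coord γ hα,
    N.weight_coord γ hβ]
  rw [mul_div_cancel_left₀ _ (hμγ.gamma_pos i α hα).ne',
    mul_div_cancel_left₀ _ (hμγ.gamma_pos i β hβ).ne']

end

section

/-! ### One null set of times for all test functions -/

theorem continuous_integral_mul_Lp {ρ : Measure ℝ} {a : ℝ → ℝ} (ha : MemLp a 2 ρ) :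
    Continuous fun z : Lp ℝ 2 ρ => ∫ y, a y * z y ∂ρ := by
  have h : (fun z : Lp ℝ 2 ρ => ∫ y, a y * z y ∂ρ) = fun z => inner ℝ (ha.toLp a) z := by
    ext z
    rw [L2.inner_def]
    refine integral_congr_ae ?_
    filter_upwards [ha.coeFn_toLp] with y hy
    simp [hy, mul_comm]
  rw [h]
  exact continuous_const.inner continuous_id

/-- A countable set of inequalities decides about all of them, since `L²` is separable. -/
theorem ae_forall_sum_integral_nonpos {A ι : Type*} [Fintype A] {ρ : A → Measure ℝ}
    [∀ α, SFinite (ρ α)] {τ : Measure ℝ} {a b : A → ℝ → ℝ → ℝ}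
    (ha : ∀ᵐ t ∂τ, ∀ α, MemLp (fun y => a α y t) 2 (ρ α))
    (hb : ∀ᵐ t ∂τ, ∀ α, MemLp (fun y => b α y t) 2 (ρ α)) {w k : ι → A → ℝ → ℝ}
    (hw : ∀ i α, MemLp (w i α) 2 (ρ α)) (hk : ∀ i α, MemLp (k i α) 2 (ρ α))
    (h : ∀ i, ∀ᵐ t ∂τ, ∑ α, ∫ y, (a α y t * w i α y + b α y t * k i α y) ∂(ρ α) ≤ 0) :
    ∀ᵐ t ∂τ, ∀ i, ∑ α, ∫ y, (a α y t * w i α y + b α y t * k i α y) ∂(ρ α) ≤ 0 := by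
  have : Fact ((2 : ENNReal) ≠ ⊤) := ⟨by simp⟩
  let J : ι → ∀ α, Lp ℝ 2 (ρ α) × Lp ℝ 2 (ρ α) := fun i α =>
    ((hw i α).toLp _, (hk i α).toLp _)
  let F : ℝ → (∀ α, Lp ℝ 2 (ρ α) × Lp ℝ 2 (ρ α)) → ℝ := fun t z =>
    ∑ α, (∫ y, a α y t * (z α).1 y ∂(ρ α) + ∫ y, b α y t * (z α).2 y ∂(ρ α))
  have hF : ∀ t i, (∀ α, MemLp (fun y => a α y t) 2 (ρ α)) →
      (∀ α, MemLp (fun y => b α y t) 2 (ρ α)) →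
      F t (J i) = ∑ α, ∫ y, (a α y t * w i α y + b α y t * k i α y) ∂(ρ α) := by
    intro t i hat hbt
    refine Finset.sum_congr rfl fun α _ => ?_
    have i1 : Integrable (fun y => a α y t * w i α y) (ρ α) := (hat α).integrable_mul (hw i α)
    have i2 : Integrable (fun y => b α y t * k i α y) (ρ α) := (hbt α).integrable_mul (hk i α)
    rw [integral_add i1 i2]
    congr 1 <;> refine integral_congr_ae ?_
    · filter_upwards [(hw i α).coeFn_toLp] with y hy
      simp only [J, hy]
    · filter_upwards [(hk i α).coeFn_toLp] with y hy
      simp only [J, hy]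
  -- The countable dense set is chosen inside the range of `J`, so each of its elements comes from
  -- an index to which `h` applies.
  obtain ⟨c, hcs, hcc, hc⟩ :=
    (TopologicalSpace.IsSeparable.of_separableSpace (range J)).exists_countable_dense_subset
  have hcF : ∀ᵐ t ∂τ, ∀ z ∈ c, F t z ≤ 0 := by
    refine (ae_ball_iff hcc).2 fun z hz => ?_
    obtain ⟨i, rfl⟩ := hcs hz
    filter_upwards [ha, hb, h i] with t hat hbt hi
    rwa [hF t i hat hbt]
  filter_upwards [ha, hb, hcF] with t hat hbt ht i
  rw [← hF t i hat hbt]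
  have hcont : Continuous (F t) := by
    refine continuous_finsetSum _ fun α _ => Continuous.add ?_ ?_
    · exact (continuous_integral_mul_Lp (hat α)).comp (continuous_fst.comp (continuous_apply α))
    · exact (continuous_integral_mul_Lp (hbt α)).comp (continuous_snd.comp (continuous_apply α))
  exact closure_minimal (s := c) (t := {z | F t z ≤ 0}) ht
    (isClosed_le hcont continuous_const) (hc ⟨i, rfl⟩)

theorem ae_memLp_slice {l T : ℝ} {g : ℝ × ℝ → ℝ}
    (hg : MemLp g 2 ((volIoo l).prod (volIoo T))) :
    ∀ᵐ t ∂(volIoo T), MemLp (fun y => g (y, t)) 2 (volIoo l) := by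
  have h1 : ∀ᵐ t ∂(volIoo T), AEStronglyMeasurable (fun y => g (y, t)) (volIoo l) :=
    hg.1.prodMk_right
  filter_upwards [h1, hg.integrable_sq.prod_left_ae] with t h2 h3
  exact (memLp_two_iff_integrable_sq h2).2 h3

/-! ### The Hamiltonian -/

variable {n : ℕ} {I A : Type*} {N : Network n I A} {C₀ : ℝ}
  {H : A → EuclideanSpace ℝ (Fin n) → ℝ → ℝ}

theorem HamiltonianAssumptions.abs_sub_le (hH : HamiltonianAssumptions N C₀ H) {α : A} {y : ℝ}
    (hy : y ∈ Icc 0 (N.length α)) (p q : ℝ) :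
    |H α (N.param α y) p - H α (N.param α y) q| ≤ C₀ * |p - q| := by
  have hd : ContDiff ℝ 1 (H α (N.param α y)) := by
    rw [← contDiffOn_univ]
    exact (hH.contDiffOn α).comp (f := fun p : ℝ => (y, p)) (by fun_prop) fun p _ => ⟨hy, mem_univ _⟩
  have := convex_univ.norm_image_sub_le_of_norm_deriv_le (𝕜 := ℝ) (f := H α (N.param α y)) (C := C₀)
    (fun x _ => (hd.differentiable one_ne_zero) x)
    (fun x _ => hH.abs_deriv_p_le α _ (N.param_mem_edge hy) x) (mem_univ q) (mem_univ p)
  simpa [Real.norm_eq_abs] using this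

theorem HamiltonianAssumptions.memLp (hH : HamiltonianAssumptions N C₀ H) (α : A) {p : ℝ → ℝ}
    (hp : MemLp p 2 (volIoo (N.length α))) :
    MemLp (fun y => H α (N.param α y) (p y)) 2 (volIoo (N.length α)) := by
  have hl := (N.length_pos α).le
  -- Regularity is available only over the closed edge; composing with the projection onto `[0,
  -- ℓ_α]` gives a globally continuous function.
  have hc : Continuous fun z : ℝ × ℝ => H α (N.param α (projIcc 0 (N.length α) hl z.1)) z.2 := by
    have h1 : Continuous fun z : ℝ × ℝ => (((projIcc 0 (N.length α) hl z.1 : ℝ), z.2) : ℝ × ℝ) :=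
      (continuous_subtype_val.comp (continuous_projIcc.comp continuous_fst)).prodMk continuous_snd
    exact (hH.contDiffOn α).continuousOn.comp_continuous h1 fun z => ⟨Subtype.coe_prop _, mem_univ _⟩
  have heq : ∀ y ∈ Icc 0 (N.length α), ∀ q,
      H α (N.param α (projIcc 0 (N.length α) hl y)) q = H α (N.param α y) q := by
    intro y hy q
    rw [projIcc_of_mem hl hy]
  have h0 : MemLp (fun y => H α (N.param α y) 0) 2 (volIoo (N.length α)) := by
    refine memLp_of_continuousOn (ContinuousOn.congr (f := fun y =>
      H α (N.param α (projIcc 0 (N.length α) hl y)) 0) ?_ fun y hy => (heq y hy 0).symm)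
    exact (hc.comp (continuous_id.prodMk continuous_const)).continuousOn
  have hm : AEStronglyMeasurable (fun y => H α (N.param α y) (p y)) (volIoo (N.length α)) := by
    have h1 : AEStronglyMeasurable (fun y => ((y, p y) : ℝ × ℝ)) (volIoo (N.length α)) :=
      aestronglyMeasurable_id.prodMk hp.1
    refine (hc.comp_aestronglyMeasurable h1).congr ?_
    filter_upwards [ae_restrict_mem measurableSet_Ioo] with y hy
    exact heq y (Ioo_subset_Icc_self hy) _
  -- A two-sided linear growth bound follows from the Lipschitz estimate in `p`, starting from `p =
  -- 0`.
  have hb : MemLp (fun y => |H α (N.param α y) 0| + C₀ * |p y|) 2 (volIoo (N.length α)) :=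
    h0.abs.add (hp.abs.const_mul C₀)
  refine hb.of_le hm ?_
  filter_upwards [ae_restrict_mem measurableSet_Ioo] with y hy
  have h1 := hH.abs_sub_le (Ioo_subset_Icc_self hy) (p y) 0
  rw [sub_zero] at h1
  rw [Real.norm_eq_abs, Real.norm_eq_abs]
  refine le_trans ?_ (le_abs_self _)
  have h2 := abs_add_le (H α (N.param α y) (p y) - H α (N.param α y) 0) (H α (N.param α y) 0)
  rw [sub_add_cancel] at h2
  linarith

/-- Here `φ` and `s` stand for the weight and its slope, `m` for the diffusion constant, `p` for
`∂u` and `h` for the difference of the Hamiltonians. Up to the factor `φ`, the claim reduces to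
nonnegativity of a quadratic form in `(|p|, u)`, and `hK` is its discriminant condition. -/
theorem absorb_gradient {φ m u p s h C R K : ℝ} (hφ : 0 < φ) (hm : 0 < m) (hu : 0 < u)
    (hh : |h| ≤ C * |p|) (hs : |s| ≤ R * φ) (hK : (C + m * R) ^ 2 ≤ 4 * K * m) :
    -(K * (φ * u ^ 2)) ≤ h * (φ * u) + m * p * (s * u + φ * p) := by
  have h1 : -(C * |p|) * (φ * u) ≤ h * (φ * u) :=
    mul_le_mul_of_nonneg_right (by linarith [neg_abs_le h]) (by positivity)
  have h2 : -(m * |p| * (R * φ) * u) ≤ m * p * (s * u) := by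
    have h3 : |p * s| ≤ |p| * (R * φ) := by
      rw [abs_mul]
      exact mul_le_mul_of_nonneg_left hs (abs_nonneg _)
    have h4 := neg_abs_le (p * s)
    have h5 : 0 ≤ m * u * (p * s + |p| * (R * φ)) := mul_nonneg (by positivity) (by linarith)
    linarith
  have h6 : 0 ≤ m * |p| ^ 2 - (C + m * R) * |p| * u + K * u ^ 2 := by
    -- Completion of the square, after multiplication by `4m`.
    have h7 : 0 ≤ (2 * m * |p| - (C + m * R) * u) ^ 2 + (4 * K * m - (C + m * R) ^ 2) * u ^ 2 :=
      add_nonneg (sq_nonneg _) (mul_nonneg (by linarith) (sq_nonneg _))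
    have h8 : 0 ≤ 4 * m * (m * |p| ^ 2 - (C + m * R) * |p| * u + K * u ^ 2) := by linarith
    exact nonneg_of_mul_nonneg_right h8 (by positivity)
  have h9 := mul_nonneg hφ.le h6
  rw [sq_abs] at h9
  linarith

end

section

/-! ### Gronwall's lemma, backward in time -/

/-- Put `F(t) = ∫_t^T E`. The hypotheses give `E ≤ K F`, and `F' = -E`, so `e^{Kt} F` is
nondecreasing. It vanishes at `T`, hence `F ≤ 0` and `E ≤ K F ≤ 0`. -/
theorem nonpos_of_backward_gronwall {T K : ℝ} (hT : 0 < T) (hK : 0 ≤ K) {E Q : ℝ → ℝ}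
    (hQ : IntegrableOn Q (Ioo 0 T)) (hE : ∀ t ∈ Icc 0 T, E t = -∫ s in t..T, Q s)
    (h : ∀ᵐ s ∂(volIoo T), -(K * E s) ≤ Q s) : ∀ t ∈ Icc 0 T, E t ≤ 0 := by
  have hQi : IntervalIntegrable Q volume 0 T :=
    (intervalIntegrable_iff_integrableOn_Ioo_of_le hT.le).2 hQ
  have hEc : ContinuousOn E (Icc 0 T) := by
    have h1 := (hQi.absolutelyContinuousOnInterval_intervalIntegral (c := T) (by simp)).continuousOn
    rw [uIcc_of_le hT.le] at h1
    exact h1.congr fun t ht => by rw [hE t ht, ← intervalIntegral.integral_symm]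
  have hEi : ∀ {p r : ℝ}, p ∈ Icc 0 T → r ∈ Icc 0 T → IntervalIntegrable E volume p r :=
    fun hp hr => (hEc.mono (ordConnected_Icc.uIcc_subset hp hr)).intervalIntegrable
  have hTT : T ∈ Icc 0 T := ⟨hT.le, le_rfl⟩
  have hEF : ∀ t ∈ Icc 0 T, E t ≤ K * ∫ s in t..T, E s := by
    intro t ht
    have hsub : uIcc t T ⊆ uIcc 0 T := by
      rw [uIcc_of_le ht.2, uIcc_of_le hT.le]
      exact Icc_subset_Icc_left ht.1
    have h1 : ∫ s in t..T, -(K * E s) ≤ ∫ s in t..T, Q s := by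
      refine intervalIntegral.integral_mono_ae_restrict ht.2 ((hEi ht hTT).const_mul K).neg
        (hQi.mono_set hsub) ?_
      rw [← Measure.restrict_congr_set (Ioo_ae_eq_Icc (a := t) (b := T))]
      exact ae_restrict_of_ae_restrict_of_subset (Ioo_subset_Ioo_left ht.1) h
    rw [intervalIntegral.integral_neg, intervalIntegral.integral_const_mul] at h1
    rw [hE t ht]
    linarith
  have hd : ∀ t ∈ Ioo 0 T, HasDerivAt (fun t => Real.exp (K * t) * ∫ s in t..T, E s)
      (Real.exp (K * t) * (K * (∫ s in t..T, E s) - E t)) t := by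
    intro t ht
    have hcat : ContinuousAt E t := hEc.continuousAt (Icc_mem_nhds ht.1 ht.2)
    have h1 : HasDerivAt (fun t => ∫ s in t..T, E s) (-E t) t :=
      intervalIntegral.integral_hasDerivAt_left (hEi (Ioo_subset_Icc_self ht) hTT)
        ((hEc.mono Ioo_subset_Icc_self).stronglyMeasurableAtFilter isOpen_Ioo t ht) hcat
    have h2 : HasDerivAt (fun t => Real.exp (K * t)) (Real.exp (K * t) * K) t := by
      simpa using ((hasDerivAt_id t).const_mul K).exp
    refine (h2.mul h1).congr_deriv ?_
    ring
  have hmono : MonotoneOn (fun t => Real.exp (K * t) * ∫ s in t..T, E s) (Icc 0 T) := by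
    refine monotoneOn_of_deriv_nonneg (convex_Icc 0 T) ?_ ?_ ?_
    · have h1 := ((hEi ⟨le_rfl, hT.le⟩ hTT).absolutelyContinuousOnInterval_intervalIntegral
        (c := T) (by simp)).continuousOn
      rw [uIcc_of_le hT.le] at h1
      refine ContinuousOn.mul (by fun_prop) (h1.neg.congr fun t _ => ?_)
      exact intervalIntegral.integral_symm _ _
    · rw [interior_Icc]
      exact fun t ht => (hd t ht).differentiableAt.differentiableWithinAt
    · rw [interior_Icc]
      intro t ht
      rw [(hd t ht).deriv]
      exact mul_nonneg (Real.exp_pos _).le (by linarith [hEF t (Ioo_subset_Icc_self ht)])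
  intro t ht
  have h1 := hmono ht hTT ht.2
  simp only [intervalIntegral.integral_same, mul_zero] at h1
  have h2 : ∫ s in t..T, E s ≤ 0 := nonpos_of_mul_nonpos_right h1 (Real.exp_pos _)
  exact (hEF t ht).trans (mul_nonpos_of_nonneg_of_nonpos hK h2)

/-! ### Comparison -/

variable {n : ℕ} {I A : Type*} {N : Network n I A} {T : ℝ}
  {v v' : EuclideanSpace ℝ (Fin n) → ℝ → ℝ} {v_t v_x v_t' v_x' : A → ℝ → ℝ → ℝ}

theorem InSolutionSpace.memLp_t (h : InSolutionSpace N T v v_t v_x) (α : A) :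
    MemLp (fun z : ℝ × ℝ => v_t α z.1 z.2) 2 ((volIoo (N.length α)).prod (volIoo T)) := by
  rw [← N.edgeTimeMeasure_eq]
  exact h.memL2_t α

theorem InSolutionSpace.ae_eq_sub_integral (h : InSolutionSpace N T v v_t v_x) (hT : 0 < T) {t : ℝ}
    (ht : t ∈ Icc 0 T) (α : A) :
    ∀ᵐ y ∂(volIoo (N.length α)),
      v (N.param α y) t = v (N.param α y) T - ∫ s in t..T, v_t α y s := by
  have h1 := h.memL2 α
  have h2 := h.weakDeriv_t α
  rw [N.edgeTimeMeasure_eq] at h1 h2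
  exact HJNetwork.ae_eq_sub_integral (u := fun y t => v (N.param α y) t) hT
    (h1.integrable one_le_two) ((h.memLp_t α).integrable one_le_two) h2
    (fun t ht => h.slice_memL2 t ht α) (fun t₀ ht₀ => h.time_continuous t₀ ht₀ α) ht

/-- The weighted energy of the positive part of a difference is a primitive. -/
theorem energy_sub_eq {γ : I → A → ℝ} (hT : 0 < T) (hS : InSolutionSpace N T v v_t v_x)
    (hS' : InSolutionSpace N T v' v_t' v_x')
    (hterm : N.AE fun x => v x T ≤ v' x T) (α : A) :
    ∃ Q : ℝ → ℝ, IntegrableOn Q (Ioo 0 T) ∧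
      (∀ᵐ t ∂(volIoo T), Q t = ∫ y, N.weight γ α y *
        (2 * max (v (N.param α y) t - v' (N.param α y) t) 0 * (v_t α y t - v_t' α y t))
        ∂(volIoo (N.length α))) ∧
      ∀ t ∈ Icc 0 T, ∫ y, N.weight γ α y * max (v (N.param α y) t - v' (N.param α y) t) 0 ^ 2
        ∂(volIoo (N.length α)) = -∫ s in t..T, Q s := by
  have hTT : T ∈ Icc 0 T := ⟨hT.le, le_rfl⟩
  have hg := (hS.memLp_t α).sub (hS'.memLp_t α)
  -- A strongly measurable representative of `∂_t u` is needed for the joint measurability of its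
  -- integrals over `(t, T)`. The resulting `Q` is matched with the given derivatives only for
  -- almost every time.
  set G := hg.1.mk _
  have hGm : StronglyMeasurable G := hg.1.stronglyMeasurable_mk
  have hGae : ∀ᵐ z ∂((volIoo (N.length α)).prod (volIoo T)),
      v_t α z.1 z.2 - v_t' α z.1 z.2 = G z := hg.1.ae_eq_mk
  have hG : MemLp G 2 ((volIoo (N.length α)).prod (volIoo T)) := (memLp_congr_ae hGae).1 hg
  have hb : MemLp (fun y => v (N.param α y) T - v' (N.param α y) T) 2 (volIoo (N.length α)) :=
    (hS.slice_memL2 T hTT α).sub (hS'.slice_memL2 T hTT α)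
  obtain ⟨C, hC⟩ := (isCompact_Icc (a := 0) (b := N.length α)).exists_bound_of_continuousOn
    (N.continuous_weight γ α).continuousOn
  have hC' : ∀ᵐ y ∂(volIoo (N.length α)), ‖N.weight γ α y‖ ≤ C := by
    filter_upwards [ae_restrict_mem measurableSet_Ioo] with y hy
    exact hC y (Ioo_subset_Icc_self hy)
  obtain ⟨hQ, hE⟩ := energy_identity hT hb hGm hG
    (N.continuous_weight γ α).aestronglyMeasurable hC'
  have hGy : ∀ᵐ y ∂(volIoo (N.length α)), ∀ᵐ s ∂(volIoo T),
      v_t α y s - v_t' α y s = G (y, s) := Measure.ae_ae_of_ae_prod hGae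
  have hGt : ∀ᵐ s ∂(volIoo T), ∀ᵐ y ∂(volIoo (N.length α)),
      v_t α y s - v_t' α y s = G (y, s) :=
    Measure.ae_ae_of_ae_prod (Measure.measurePreserving_swap.quasiMeasurePreserving.ae hGae)
  have hU : ∀ t ∈ Icc 0 T, ∀ᵐ y ∂(volIoo (N.length α)),
      v (N.param α y) t - v' (N.param α y) t =
        v (N.param α y) T - v' (N.param α y) T - ∫ s in t..T, G (y, s) := by
    intro t ht
    filter_upwards [hS.ae_eq_sub_integral hT ht α, hS'.ae_eq_sub_integral hT ht α, hGy,
      ((hS.memLp_t α).integrable one_le_two).prod_right_ae,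
      ((hS'.memLp_t α).integrable one_le_two).prod_right_ae] with y h1 h2 h3 h4 h5
    have hii : ∀ {k : ℝ → ℝ}, Integrable k (volIoo T) → IntervalIntegrable k volume t T :=
      fun hk => (intervalIntegrable_iff_integrableOn_Ioo_of_le ht.2).2
        (IntegrableOn.mono_set hk (Ioo_subset_Ioo_left ht.1))
    have h6 : ∫ s in t..T, G (y, s) = ∫ s in t..T, (v_t α y s - v_t' α y s) := by
      simp only [intervalIntegral.integral_of_le ht.2, integral_Ioc_eq_integral_Ioo]
      refine integral_congr_ae ?_
      filter_upwards [ae_restrict_of_ae_restrict_of_subset (Ioo_subset_Ioo_left ht.1) h3]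
        with s hs
      exact hs.symm
    rw [h6, intervalIntegral.integral_sub (hii h4) (hii h5), h1, h2]
    ring
  refine ⟨_, hQ, ?_, fun t ht => ?_⟩
  · filter_upwards [hGt, ae_restrict_mem measurableSet_Ioo] with t h1 ht
    refine integral_congr_ae ?_
    filter_upwards [h1, hU t (Ioo_subset_Icc_self ht)] with y h2 h3
    rw [h2, h3]
  · have h0 : ∫ y, N.weight γ α y * max (v (N.param α y) T - v' (N.param α y) T) 0 ^ 2
        ∂(volIoo (N.length α)) = 0 := by
      refine integral_eq_zero_of_ae ?_
      filter_upwards [hterm α] with y hy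
      simp [max_eq_right (sub_nonpos.2 hy)]
    have h1 := hE t ht
    rw [h0, zero_sub] at h1
    rw [← h1]
    refine integral_congr_ae ?_
    filter_upwards [hU t ht] with y hy
    rw [hy]

variable [Fintype A]

theorem InSolutionSpace.ae_memLp_t (h : InSolutionSpace N T v v_t v_x) :
    ∀ᵐ t ∂(volIoo T), ∀ α, MemLp (fun y => v_t α y t) 2 (volIoo (N.length α)) :=
  ae_all_iff.2 fun α => ae_memLp_slice (h.memLp_t α)

theorem InSolutionSpace.ae_memLp_x (h : InSolutionSpace N T v v_t v_x) :
    ∀ᵐ t ∂(volIoo T), ∀ α, MemLp (fun y => v_x α y t) 2 (volIoo (N.length α)) := by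
  refine ae_all_iff.2 fun α => ae_memLp_slice (g := fun z => v_x α z.1 z.2) ?_
  rw [← N.edgeTimeMeasure_eq]
  exact h.memL2_x α

variable {μ : A → ℝ} {γ : I → A → ℝ} {C₀ : ℝ} {H : A → EuclideanSpace ℝ (Fin n) → ℝ → ℝ}
  {f : EuclideanSpace ℝ (Fin n) → ℝ → ℝ}

/-- The difference of the weak inequalities, for almost every time and all test functions. -/
theorem ae_forall_test_le (hH : HamiltonianAssumptions N C₀ H)
    (hS : InSolutionSpace N T v v_t v_x) (hS' : InSolutionSpace N T v' v_t' v_x')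
    (hsub : ∀ w : EuclideanSpace ℝ (Fin n) → ℝ, MemW N γ w → (∀ x ∈ N.carrier, 0 ≤ w x) →
      ∀ w_x : A → ℝ → ℝ, (∀ α, HasWeakDerivOn 0 (N.length α) (N.pull w α) (w_x α)) →
        ∀ᵐ t ∂(volume.restrict (Ioo 0 T)), weakForm N μ H v_t v_x w w_x t ≤ sourceForm N f w t)
    (hsup : ∀ w : EuclideanSpace ℝ (Fin n) → ℝ, MemW N γ w → (∀ x ∈ N.carrier, 0 ≤ w x) →
      ∀ w_x : A → ℝ → ℝ, (∀ α, HasWeakDerivOn 0 (N.length α) (N.pull w α) (w_x α)) →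
        ∀ᵐ t ∂(volume.restrict (Ioo 0 T)),
          sourceForm N f w t ≤ weakForm N μ H v_t' v_x' w w_x t) :
    ∀ᵐ t ∂(volIoo T), ∀ (w : EuclideanSpace ℝ (Fin n) → ℝ) (w_x : A → ℝ → ℝ), MemW N γ w →
      (∀ x, 0 ≤ w x) → (∀ α, HasWeakDerivOn 0 (N.length α) (N.pull w α) (w_x α)) →
      (∀ α, MemLp (w_x α) 2 (volIoo (N.length α))) →
      ∑ α, ∫ y, ((-(v_t α y t - v_t' α y t) +
        (H α (N.param α y) (v_x α y t) - H α (N.param α y) (v_x' α y t))) * N.pull w α y +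
        μ α * (v_x α y t - v_x' α y t) * w_x α y) ∂(volIoo (N.length α)) ≤ 0 := by
  -- The index is a test function together with a weak derivative, since the inequality is
  -- continuous in this pair with respect to `L²`.
  let ι := {p : (EuclideanSpace ℝ (Fin n) → ℝ) × (A → ℝ → ℝ) // MemW N γ p.1 ∧ (∀ x, 0 ≤ p.1 x) ∧
    (∀ α, HasWeakDerivOn 0 (N.length α) (N.pull p.1 α) (p.2 α)) ∧
    ∀ α, MemLp (p.2 α) 2 (volIoo (N.length α))}
  have key := ae_forall_sum_integral_nonpos (ι := ι) (ρ := fun α => volIoo (N.length α))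
    (τ := volIoo T)
    (a := fun α y t => -(v_t α y t - v_t' α y t) +
      (H α (N.param α y) (v_x α y t) - H α (N.param α y) (v_x' α y t)))
    (b := fun α y t => μ α * (v_x α y t - v_x' α y t))
    (w := fun p α => N.pull p.1.1 α) (k := fun p α => p.1.2 α) ?_ ?_
    (fun p α => (p.2.1.1 α).1) (fun p α => p.2.2.2.2 α) ?_
  · filter_upwards [key] with t ht w w_x h1 h2 h3 h4
    exact ht ⟨(w, w_x), h1, h2, h3, h4⟩
  · filter_upwards [hS.ae_memLp_t, hS'.ae_memLp_t, hS.ae_memLp_x, hS'.ae_memLp_x]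
      with t h1 h2 h3 h4 α
    exact ((h1 α).sub (h2 α)).neg.add ((hH.memLp α (h3 α)).sub (hH.memLp α (h4 α)))
  · filter_upwards [hS.ae_memLp_x, hS'.ae_memLp_x] with t h3 h4 α
    exact ((h3 α).sub (h4 α)).const_mul _
  · rintro ⟨⟨w, w_x⟩, h1, h2, h3, h4⟩
    filter_upwards [hsub w h1 (fun x _ => h2 x) w_x h3, hsup w h1 (fun x _ => h2 x) w_x h3,
      hS.ae_memLp_t, hS'.ae_memLp_t, hS.ae_memLp_x, hS'.ae_memLp_x] with t h5 h6 m1 m2 m3 m4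
    have h7 : weakForm N μ H v_t v_x w w_x t - weakForm N μ H v_t' v_x' w w_x t ≤ 0 := by linarith
    refine le_of_eq_of_le ?_ h7
    have hint : ∀ {p q : A → ℝ → ℝ → ℝ} (α : A),
        MemLp (fun y => p α y t) 2 (volIoo (N.length α)) →
        MemLp (fun y => q α y t) 2 (volIoo (N.length α)) →
        Integrable (fun y => -(p α y t) * N.pull w α y + μ α * q α y t * w_x α y
          + H α (N.param α y) (q α y t) * N.pull w α y) (volIoo (N.length α)) := by
      intro p q α hp hq
      exact ((hp.neg.integrable_mul (h1.1 α).1).add ((hq.const_mul (μ α)).integrable_mul (h4 α))).add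
        ((hH.memLp α hq).integrable_mul (h1.1 α).1)
    unfold weakForm
    rw [← Finset.sum_sub_distrib]
    refine Finset.sum_congr rfl fun α _ => ?_
    unfold Network.edgeMeasure
    rw [← integral_sub (hint α (m1 α) (m3 α)) (hint α (m2 α) (m4 α))]
    congr 1
    ext y
    ring

/-- This is `E' ≥ -K E`, with the right-hand side in place of `E'`. The test function is rebuilt
from `u(·,t)` at each time, which is legitimate because the exceptional null set does not depend on
it. -/
theorem ae_neg_energy_le (hμγ : CoefficientAssumptions N μ γ) (hH : HamiltonianAssumptions N C₀ H)
    (hS : InSolutionSpace N T v v_t v_x) (hS' : InSolutionSpace N T v' v_t' v_x')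
    (hsub : ∀ w : EuclideanSpace ℝ (Fin n) → ℝ, MemW N γ w → (∀ x ∈ N.carrier, 0 ≤ w x) →
      ∀ w_x : A → ℝ → ℝ, (∀ α, HasWeakDerivOn 0 (N.length α) (N.pull w α) (w_x α)) →
        ∀ᵐ t ∂(volume.restrict (Ioo 0 T)), weakForm N μ H v_t v_x w w_x t ≤ sourceForm N f w t)
    (hsup : ∀ w : EuclideanSpace ℝ (Fin n) → ℝ, MemW N γ w → (∀ x ∈ N.carrier, 0 ≤ w x) →
      ∀ w_x : A → ℝ → ℝ, (∀ α, HasWeakDerivOn 0 (N.length α) (N.pull w α) (w_x α)) →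
        ∀ᵐ t ∂(volume.restrict (Ioo 0 T)),
          sourceForm N f w t ≤ weakForm N μ H v_t' v_x' w w_x t) :
    ∃ K, 0 ≤ K ∧ ∀ᵐ t ∂(volIoo T),
      -(K * ∑ α, ∫ y, N.weight γ α y * max (v (N.param α y) t - v' (N.param α y) t) 0 ^ 2
        ∂(volIoo (N.length α))) ≤
      ∑ α, ∫ y, N.weight γ α y * (2 * max (v (N.param α y) t - v' (N.param α y) t) 0 *
        (v_t α y t - v_t' α y t)) ∂(volIoo (N.length α)) := by
  -- `R` bounds the logarithmic derivative of the weight, which is at least the smaller of its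
  -- endpoint values; `K₀` turns the discriminant condition of `absorb_gradient` into an equality on
  -- each edge.
  let R : A → ℝ := fun α => |N.weightSlope γ α| / min (γ (N.src α) α) (γ (N.tgt α) α)
  let K₀ : A → ℝ := fun α => (C₀ + μ α * R α) ^ 2 / (4 * μ α)
  have hK₀ : ∀ α, 0 ≤ K₀ α := fun α => by
    have := hμγ.mu_pos α
    positivity
  have hR : ∀ α, ∀ y ∈ Icc 0 (N.length α), |N.weightSlope γ α| ≤ R α * N.weight γ α y := by
    intro α y hy
    have h0 := hμγ.min_pos α
    calc |N.weightSlope γ α| = R α * min (γ (N.src α) α) (γ (N.tgt α) α) :=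
          (div_mul_cancel₀ _ h0.ne').symm
      _ ≤ _ := mul_le_mul_of_nonneg_left (N.min_le_weight γ hy) (by positivity)
  have hK : ∀ α, (C₀ + μ α * R α) ^ 2 ≤ 4 * (∑ β, K₀ β) * μ α := by
    intro α
    have h1 := hμγ.mu_pos α
    have h2 : K₀ α ≤ ∑ β, K₀ β :=
      Finset.single_le_sum (fun β _ => hK₀ β) (Finset.mem_univ α)
    have h3 : (C₀ + μ α * R α) ^ 2 = 4 * K₀ α * μ α := by
      simp only [K₀]
      field_simp
    rw [h3]
    nlinarith
  -- Summing the nonnegative `K₀ α` gives a single constant for all edges; the factor `2` comes from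
  -- differentiating the square.
  refine ⟨2 * ∑ α, K₀ α, mul_nonneg zero_le_two (Finset.sum_nonneg fun α _ => hK₀ α), ?_⟩
  filter_upwards [ae_forall_test_le hH hS hS' hsub hsup, hS.continuousOn, hS'.continuousOn,
    hS.ae_memLp_t, hS'.ae_memLp_t, hS.ae_memLp_x, hS'.ae_memLp_x,
    ae_all_iff.2 hS.weakDeriv_x, ae_all_iff.2 hS'.weakDeriv_x]
    with t htest hc hc' m1 m2 m3 m4 hx hx'
  have hcu : ContinuousOn (fun x => v x t - v' x t) N.carrier := hc.sub hc'
  have hg : ∀ α, MemLp (fun y => v_x α y t - v_x' α y t) 2 (volIoo (N.length α)) :=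
    fun α => (m3 α).sub (m4 α)
  obtain ⟨w, w_x, hW, hw0, hw, hwd, hwx, hae⟩ := exists_test_function N hμγ hcu hg fun α =>
    (hx α).sub (hx' α) ((memLp_of_continuousOn (N.continuousOn_pull hc α)).integrable one_le_two)
      ((memLp_of_continuousOn (N.continuousOn_pull hc' α)).integrable one_le_two)
      ((m3 α).integrable one_le_two) ((m4 α).integrable one_le_two)
  have h := htest w w_x hW hw0 hwd hwx
  have hu : ∀ α, ContinuousOn (fun y => max (v (N.param α y) t - v' (N.param α y) t) 0)
      (Icc 0 (N.length α)) := fun α =>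
    (N.continuousOn_pull hcu α).sup continuousOn_const
  have i1 : ∀ α, Integrable (fun y => N.weight γ α y *
      max (v (N.param α y) t - v' (N.param α y) t) 0 ^ 2) (volIoo (N.length α)) := fun α =>
    (memLp_of_continuousOn ((N.continuous_weight γ α).continuousOn.mul ((hu α).pow 2))).integrable
      one_le_two
  have i2 : ∀ α, Integrable (fun y => N.weight γ α y *
      (2 * max (v (N.param α y) t - v' (N.param α y) t) 0 * (v_t α y t - v_t' α y t)))
      (volIoo (N.length α)) := by
    intro α
    have h1 : Integrable (fun y => (N.weight γ α y *
        (2 * max (v (N.param α y) t - v' (N.param α y) t) 0)) * (v_t α y t - v_t' α y t))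
        (volIoo (N.length α)) :=
      (memLp_of_continuousOn ((N.continuous_weight γ α).continuousOn.mul
        (continuousOn_const.mul (hu α)))).integrable_mul ((m1 α).sub (m2 α))
    simpa only [mul_assoc] using h1
  have key : ∀ α, (∫ y, -(N.weight γ α y *
        (2 * max (v (N.param α y) t - v' (N.param α y) t) 0 * (v_t α y t - v_t' α y t)))
        ∂(volIoo (N.length α))) -
      (2 * ∑ β, K₀ β) * ∫ y, N.weight γ α y *
        max (v (N.param α y) t - v' (N.param α y) t) 0 ^ 2 ∂(volIoo (N.length α)) ≤
      2 * ∫ y, ((-(v_t α y t - v_t' α y t) +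
        (H α (N.param α y) (v_x α y t) - H α (N.param α y) (v_x' α y t))) * N.pull w α y +
        μ α * (v_x α y t - v_x' α y t) * w_x α y) ∂(volIoo (N.length α)) := by
    intro α
    have i3 : Integrable (fun y => -(N.weight γ α y *
        (2 * max (v (N.param α y) t - v' (N.param α y) t) 0 * (v_t α y t - v_t' α y t))))
        (volIoo (N.length α)) := (i2 α).neg
    rw [← integral_const_mul, ← integral_const_mul, ← integral_sub i3 ((i1 α).const_mul _)]
    refine integral_mono_ae (i3.sub ((i1 α).const_mul _)) (Integrable.const_mul ?_ 2) ?_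
    · exact ((((m1 α).sub (m2 α)).neg.add ((hH.memLp α (m3 α)).sub
        (hH.memLp α (m4 α)))).integrable_mul (hW.1 α).1).add
        ((((m3 α).sub (m4 α)).const_mul (μ α)).integrable_mul (hwx α))
    · filter_upwards [hae α, ae_restrict_mem measurableSet_Ioo] with y hy hyI
      have hyI' := Ioo_subset_Icc_self hyI
      simp only [Network.pull] at hy hw
      simp only [Network.pull, hw α y hyI]
      -- Where `u ≤ 0`, the test function and its derivative both vanish and the two sides are zero;
      -- elsewhere the gradient terms are absorbed.
      rcases le_or_gt (v (N.param α y) t - v' (N.param α y) t) 0 with hle | hgt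
      · rw [hy.1 hle, max_eq_right hle]
        simp
      · rw [hy.2 hgt, max_eq_left hgt.le]
        have := absorb_gradient (hμγ.weight_pos hyI') (hμγ.mu_pos α) hgt
          (hH.abs_sub_le hyI' (v_x α y t) (v_x' α y t)) (hR α y hyI') (hK α)
        linarith
  have hsum := Finset.sum_le_sum fun α (_ : α ∈ Finset.univ) => key α
  rw [← Finset.mul_sum, Finset.sum_sub_distrib, ← Finset.mul_sum] at hsum
  simp only [integral_neg, Finset.sum_neg_distrib] at hsum
  linarith

/-- The comparison principle, at every time and almost everywhere on the network. -/
theorem ae_le_of_weakSub_weakSuper (hT : 0 < T) (hμγ : CoefficientAssumptions N μ γ)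
    (hH : HamiltonianAssumptions N C₀ H) {vT : EuclideanSpace ℝ (Fin n) → ℝ}
    (hv : IsWeakSubsolution N T μ γ H f vT v) (hv' : IsWeakSupersolution N T μ γ H f vT v') :
    ∀ t ∈ Icc 0 T, N.AE fun x => v x t ≤ v' x t := by
  obtain ⟨v_t, v_x, hS, hsub, hend⟩ := hv
  obtain ⟨v_t', v_x', hS', hsup, hend'⟩ := hv'
  have hterm : N.AE fun x => v x T ≤ v' x T := by
    intro α
    filter_upwards [hend α, hend' α] with y h1 h2
    exact h1.trans h2
  obtain ⟨K, hK, hKE⟩ := ae_neg_energy_le hμγ hH hS hS' hsub hsup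
  choose Q hQ hQae hQE using fun α => energy_sub_eq (γ := γ) hT hS hS' hterm α
  have hnonneg : ∀ t α, 0 ≤ᵐ[volIoo (N.length α)] fun y => N.weight γ α y *
      max (v (N.param α y) t - v' (N.param α y) t) 0 ^ 2 := by
    intro t α
    filter_upwards [ae_restrict_mem measurableSet_Ioo] with y hy
    exact mul_nonneg (hμγ.weight_pos (Ioo_subset_Icc_self hy)).le (sq_nonneg _)
  have hE := nonpos_of_backward_gronwall hT hK (Q := fun t => ∑ α, Q α t)
    (E := fun t => ∑ α, ∫ y, N.weight γ α y *
      max (v (N.param α y) t - v' (N.param α y) t) 0 ^ 2 ∂(volIoo (N.length α)))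
    (integrable_finsetSum _ fun α _ => hQ α) (fun t ht => by
      rw [intervalIntegral.integral_finsetSum fun α _ => ?_, ← Finset.sum_neg_distrib]
      · exact Finset.sum_congr rfl fun α _ => hQE α t ht
      · exact (intervalIntegrable_iff_integrableOn_Ioo_of_le ht.2).2
          ((hQ α).mono_set (Ioo_subset_Ioo_left ht.1))) (by
      filter_upwards [hKE, ae_all_iff.2 hQae] with t h1 h2
      simpa only [h2] using h1)
  intro t ht α
  have h1 : ∫ y, N.weight γ α y * max (v (N.param α y) t - v' (N.param α y) t) 0 ^ 2
      ∂(volIoo (N.length α)) = 0 := by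
    -- The energy is a sum of nonnegative edge contributions and is at most zero, so each
    -- contribution vanishes.
    refine le_antisymm (le_trans ?_ (hE t ht)) (integral_nonneg_of_ae (hnonneg t α))
    exact Finset.single_le_sum (f := fun α => ∫ y, N.weight γ α y *
      max (v (N.param α y) t - v' (N.param α y) t) 0 ^ 2 ∂(volIoo (N.length α)))
      (fun β _ => integral_nonneg_of_ae (hnonneg t β)) (Finset.mem_univ α)
  have hu : MemLp (fun y => v (N.param α y) t - v' (N.param α y) t) 2 (volIoo (N.length α)) :=
    (hS.slice_memL2 t ht α).sub (hS'.slice_memL2 t ht α)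
  obtain ⟨C, hC⟩ := (isCompact_Icc (a := 0) (b := N.length α)).exists_bound_of_continuousOn
    (N.continuous_weight γ α).continuousOn
  have hi : Integrable (fun y => N.weight γ α y *
      max (v (N.param α y) t - v' (N.param α y) t) 0 ^ 2) (volIoo (N.length α)) := by
    have h2 : MemLp (fun y => max (v (N.param α y) t - v' (N.param α y) t) 0) 2
        (volIoo (N.length α)) := hu.pos_part
    refine h2.integrable_sq.bdd_mul (c := C) (N.continuous_weight γ α).aestronglyMeasurable ?_
    filter_upwards [ae_restrict_mem measurableSet_Ioo] with y hy
    exact hC y (Ioo_subset_Icc_self hy)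
  -- The weight is positive, so a vanishing integral forces `u⁺ = 0` almost everywhere.
  have h3 := (integral_eq_zero_iff_of_nonneg_ae (hnonneg t α) hi).1 h1
  change ∀ᵐ y ∂(volIoo (N.length α)), _
  filter_upwards [h3, ae_restrict_mem measurableSet_Ioo] with y hy hyI
  have h4 := hμγ.weight_pos (Ioo_subset_Icc_self hyI)
  have h5 : max (v (N.param α y) t - v' (N.param α y) t) 0 = 0 := by
    simpa [h4.ne'] using hy
  linarith [max_eq_right_iff.1 h5]

end

end HJNetwork

end

theorem mainTheorem8 {n : ℕ} {I A : Type*} [Fintype I] [Fintype A]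
    (N : HJNetwork.Network n I A) (T : ℝ) (hT : 0 < T)
    (μ : A → ℝ) (γ : I → A → ℝ) (hμγ : HJNetwork.CoefficientAssumptions N μ γ)
    (C₀ : ℝ) (H : A → EuclideanSpace ℝ (Fin n) → ℝ → ℝ)
    (hH : HJNetwork.HamiltonianAssumptions N C₀ H)
    (f : EuclideanSpace ℝ (Fin n) → ℝ → ℝ) (hf : N.MemL2SpaceTime T f)
    (vT : EuclideanSpace ℝ (Fin n) → ℝ) (hvT : HJNetwork.MemV N vT)
    (v v' : EuclideanSpace ℝ (Fin n) → ℝ → ℝ)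
    (hv : HJNetwork.IsWeakSubsolution N T μ γ H f vT v)
    (hv' : HJNetwork.IsWeakSupersolution N T μ γ H f vT v') :
    (∀ t ∈ Ioo 0 T, N.AE fun x => v x t ≤ v' x t) ∧
    (∀ t ∈ Ioo 0 T, ContinuousOn (fun x => v x t) N.carrier →
      ContinuousOn (fun x => v' x t) N.carrier → ∀ x ∈ N.carrier, v x t ≤ v' x t) := by
  have h := HJNetwork.ae_le_of_weakSub_weakSuper hT hμγ hH hv hv'
  exact ⟨fun t ht => h t (Ioo_subset_Icc_self ht), fun t ht hc hc' =>
    (h t (Ioo_subset_Icc_self ht)).le_of_continuousOn hc hc'⟩
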